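/- Let $d>0$, $h_0>0$. Let $J:\mathbb R\to\mathbb R$ be continuous, bounded, nonnegative and even, with $J(0)>0$ and $\int_{\mathbb R}J=1$; put $j(x)=\int_0^\infty J(x-y)\,dy$. Let $f\in C^1(\mathbb R)$ satisfy $f(0)=0<f'(0)$, $f(u^*)=0>f'(u^*)$ for some $u^*>0$, and let $u\mapsto f(u)/u$ be strictly decreasing on $(0,\infty)$. Let $u_0\in C([0,h_0])$ with $u_0(h_0)=0$ and $u_0>0$ on $[0,h_0)$. For every $\mu>0$ let $(u_\mu,h_\mu)$ be a global solution of the free boundary problem $$\begin{cases}u_t=d\int_0^{h(t)}J(x-y)u(t,y)\,dy-d\,j(x)u+f(u), & t>0,\ 0\le x<h(t),\\ u(t,h(t))=0, & t>0,\\ h'(t)=\mu\int_0^{h(t)}\int_{h(t)}^\infty J(x-y)u(t,x)\,dy\,dx, & t>0,\\ h(0)=h_0,\quad u(0,x)=u_0(x), & 0\le x\le h_0,\end{cases}$$ with $h$ continuous on $[0,\infty)$ and $u$ continuous on $\{(t,x):t\ge0,\ 0\le x\le h(t)\}$. Let $v\in C([0,\infty)\times[0,h_0])$ be a solution of $$v_t=d\int_0^{h_0}J(x-y)v(t,y)\,dy-d\,j(x)v+f(v)\quad(t>0,\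 0\le x\le h_0),\qquad v(0,x)=u_0(x)\quad(0\le x\le h_0),$$ and let $V\in C([0,\infty)\times[0,\infty))$, bounded on $[0,T]\times[0,\infty)$ for every $T>0$, be a solution of $$V_t=d\int_0^\infty J(x-y)\bigl(V(t,y)-V(t,x)\bigr)\,dy+f(V)\quad(t>0,\ x\ge0),$$ $$V(0,x)=u_0(x)\quad(0\le x\le h_0),\qquad V(0,x)=0\quad(x\ge h_0).$$ Then: (1) As $\mu\to0^+$, $u_\mu\to v$ and $\partial_tu_\mu\to\partial_tv$ uniformly on compact subsets of $(0,\infty)\times[0,h_0]$, and $h_\mu\to h_0$ and $h_\mu'\to0$ uniformly on compact subsets of $(0,\infty)$ (that is, $h_\mu\to h_0$ in $C^1_{\rm loc}((0,\infty))$). (2) As $\mu\to\infty$, $u_\mu\to V$ uniformly on compact subsets of $(0,\infty)\times(0,\infty)$, and $h_\mu\to\infty$ uniformly on compact subsets of $(0,\infty)$. -/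

import Mathlib

open Set Filter Topology MeasureTheory

/-- Standing condition on the dispersal kernel: `J ∈ C(ℝ) ∩ L^∞(ℝ)`, `J ≥ 0`, `J(0) > 0`,
`∫ J = 1`, and `J` is even. -/
structure IsDispersalKernel (J : ℝ → ℝ) : Prop where
  continuous : Continuous J
  bounded : ∃ C : ℝ, ∀ x, J x ≤ C
  nonneg : ∀ x, 0 ≤ J x
  pos_zero : 0 < J 0
  integrable : Integrable J
  integral_eq_one : ∫ x, J x = 1
  even : ∀ x, J (-x) = J x

/-- Monostable (KPP type) growth term. -/
structure IsMonostable (f : ℝ → ℝ) : Prop where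
  contDiff : ContDiff ℝ 1 f
  zero : f 0 = 0
  deriv_zero_pos : 0 < deriv f 0
  exists_pos_zero : ∃ ustar : ℝ, 0 < ustar ∧ f ustar = 0 ∧ deriv f ustar < 0
  strictAntiOn_div : StrictAntiOn (fun s : ℝ => f s / s) (Ioi 0)

/-- Initial function: `u₀ ∈ C([0,h₀])`, `u₀(h₀) = 0 < u₀(x)` for `x ∈ [0,h₀)`. -/
structure IsInitialDatum (h₀ : ℝ) (u₀ : ℝ → ℝ) : Prop where
  continuousOn : ContinuousOn u₀ (Icc 0 h₀)
  end_eq_zero : u₀ h₀ = 0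
  pos : ∀ x ∈ Ico 0 h₀, 0 < u₀ x

/-- `j(x) = ∫_0^∞ J(x - y) dy`. -/
noncomputable def halfLineMass (J : ℝ → ℝ) (x : ℝ) : ℝ :=
  ∫ y in Ioi (0 : ℝ), J (x - y)

/-- `(u, h)` is a (global, classical) solution of the free boundary problem
`u_t = d ∫_0^{h(t)} J(x-y) u(t,y) dy - d j(x) u + f(u)` for `t > 0`, `0 ≤ x < h(t)`,
`u(t,h(t)) = 0`, `h'(t) = μ ∫_0^{h(t)} ∫_{h(t)}^∞ J(x-y) u(t,x) dy dx` for `t > 0`,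
`h(0) = h₀`, `u(0,x) = u₀(x)` on `[0,h₀]`.
The values of `u` off the set `t ≥ 0`, `0 ≤ x ≤ h(t)` are irrelevant. -/
structure IsFreeBoundarySolution (d μ h₀ : ℝ) (J f u₀ : ℝ → ℝ)
    (u : ℝ → ℝ → ℝ) (h : ℝ → ℝ) : Prop where
  continuousOn_h : ContinuousOn h (Ici 0)
  continuousOn_u :
    ContinuousOn (fun p : ℝ × ℝ => u p.1 p.2) {p | 0 ≤ p.1 ∧ 0 ≤ p.2 ∧ p.2 ≤ h p.1}
  eq_u : ∀ t x : ℝ, 0 < t → 0 ≤ x → x < h t →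
    HasDerivAt (fun s => u s x)
      (d * (∫ y in Icc 0 (h t), J (x - y) * u t y) - d * halfLineMass J x * u t x
        + f (u t x)) t
  boundary : ∀ t : ℝ, 0 < t → u t (h t) = 0
  eq_h : ∀ t : ℝ, 0 < t →
    HasDerivAt h (μ * ∫ x in Icc 0 (h t), ∫ y in Ioi (h t), J (x - y) * u t x) t
  init_h : h 0 = h₀
  init_u : ∀ x ∈ Icc 0 h₀, u 0 x = u₀ x

/-- `v ∈ C([0,∞) × [0,h₀])` solves the fixed domain problem
`v_t = d ∫_0^{h₀} J(x-y) v(t,y) dy - d j(x) v + f(v)` for `t > 0`, `x ∈ [0,h₀]`,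
`v(0,x) = u₀(x)`. -/
structure IsFixedDomainSolution (d h₀ : ℝ) (J f u₀ : ℝ → ℝ) (v : ℝ → ℝ → ℝ) : Prop where
  continuousOn : ContinuousOn (fun p : ℝ × ℝ => v p.1 p.2) (Ici 0 ×ˢ Icc 0 h₀)
  eq_v : ∀ t x : ℝ, 0 < t → x ∈ Icc 0 h₀ →
    HasDerivAt (fun s => v s x)
      (d * (∫ y in Icc 0 h₀, J (x - y) * v t y) - d * halfLineMass J x * v t x
        + f (v t x)) t
  init : ∀ x ∈ Icc 0 h₀, v 0 x = u₀ x

/-- `V ∈ C([0,∞) × [0,∞))`, bounded on `[0,T] × [0,∞)` for every `T` (the usual class in which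
the Cauchy problem is well posed), solves
`V_t = d ∫_0^∞ J(x-y) (V(t,y) - V(t,x)) dy + f(V)` for `t > 0`, `x ≥ 0`,
`V(0,x) = u₀(x)` on `[0,h₀]`, `V(0,x) = 0` for `x ≥ h₀`. -/
structure IsHalfLineSolution (d h₀ : ℝ) (J f u₀ : ℝ → ℝ) (V : ℝ → ℝ → ℝ) : Prop where
  continuousOn : ContinuousOn (fun p : ℝ × ℝ => V p.1 p.2) (Ici 0 ×ˢ Ici 0)
  bounded : ∀ T : ℝ, ∃ C : ℝ, ∀ t ∈ Icc 0 T, ∀ x : ℝ, 0 ≤ x → |V t x| ≤ C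
  eq_V : ∀ t x : ℝ, 0 < t → 0 ≤ x →
    HasDerivAt (fun s => V s x)
      (d * (∫ y in Ioi (0 : ℝ), J (x - y) * (V t y - V t x)) + f (V t x)) t
  init_inner : ∀ x ∈ Icc 0 h₀, V 0 x = u₀ x
  init_outer : ∀ x : ℝ, h₀ ≤ x → V 0 x = 0

/-! All bounds must be uniform in μ. A maximum principle gives `0 ≤ u ≤ M`, where `M` depends only
on `f` and `u₀`. Hence `h` is nondecreasing, `h' ≤ μ M h`, and `|u_t|` is bounded independently of
μ.

As μ → 0, the inequality `h' ≤ μ M h` gives `h(t) - h₀ ≤ h₀ (exp(μMT) - 1)` up to time `T`. On `[0,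
h₀]` the equations for `v` and `u` differ only by the integral over `(h₀, h(t)]`, which is of that
size. Grönwall controls `v - u`, and the equations then control the difference of the time
derivatives.

As μ → ∞, the front passes any given point in arbitrarily short time. By induction on steps of fixed
length `s`, a positive lower bound for `u` near the edge of the interval already reached forces an
outward flux bounded below. A large μ turns it into an advance of `2s`, and dispersal then makes `u`
positive on the next step (`exists_lower_bound_of_large_rate`).

The equations for `V` and `u` then agree on a large interval up to the kernel tail, but `V - u` is
not small near the front. So the Grönwall iteration `abs_le_of_abs_deriv_le_nested` runs on
intervals that lose a length `ρ` at each step: a point of the smaller interval sees the larger one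
within distance `ρ`, and the rest through a small tail. After `n` steps the crude bound carries a
factor `(Lt)^n / n!`. The iteration starts at a small time `δ`, when the front is already far out;
`u` and `V` have by then moved only `O(δ)` from their common initial state. -/

theorem mul_sub_le_setIntegral {A : Set ℝ} (hA : MeasurableSet A) {g : ℝ → ℝ}
    (hg : IntegrableOn g A) (hg0 : ∀ y ∈ A, 0 ≤ g y) {p q m : ℝ} (hpq : p ≤ q)
    (hsub : Icc p q ⊆ A) (hm : ∀ y ∈ Icc p q, m ≤ g y) :
    m * (q - p) ≤ ∫ y in A, g y := by
  have h1 : ∫ y in Icc p q, g y ≤ ∫ y in A, g y :=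
    setIntegral_mono_set hg ((ae_restrict_iff' hA).2 (Eventually.of_forall hg0))
      (Eventually.of_forall hsub)
  have h2 : ∫ _ in Icc p q, m ≤ ∫ y in Icc p q, g y :=
    setIntegral_mono_on (integrableOn_const (by simp)) (hg.mono_set hsub) measurableSet_Icc hm
  have h3 : ∫ _ in Icc p q, m = m * (q - p) := by
    simp [Measure.real, hpq, mul_comm]
  linarith

/-! ### Kernel and flux estimates -/

/-- The part of the kernel at distance at least `ρ` from the origin. -/
noncomputable def kernelTail (J : ℝ → ℝ) (ρ : ℝ) : ℝ → ℝ :=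
  indicator {z | ρ ≤ |z|} J

namespace IsDispersalKernel

variable {J : ℝ → ℝ}

theorem integrable_sub (hJ : IsDispersalKernel J) (x : ℝ) : Integrable fun y => J (x - y) :=
  hJ.integrable.comp_sub_left x

theorem integral_sub (hJ : IsDispersalKernel J) (x : ℝ) : ∫ y, J (x - y) = 1 := by
  rw [integral_sub_left_eq_self (fun z => J z) volume x, hJ.integral_eq_one]

theorem setIntegral_nonneg (hJ : IsDispersalKernel J) (s : Set ℝ) (x : ℝ) :
    0 ≤ ∫ y in s, J (x - y) :=
  integral_nonneg fun _ => hJ.nonneg _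

theorem setIntegral_le_one (hJ : IsDispersalKernel J) (s : Set ℝ) (x : ℝ) :
    ∫ y in s, J (x - y) ≤ 1 :=
  (setIntegral_le_integral (hJ.integrable_sub x)
    (Eventually.of_forall fun _ => hJ.nonneg _)).trans (hJ.integral_sub x).le

theorem halfLineMass_nonneg (hJ : IsDispersalKernel J) (x : ℝ) : 0 ≤ halfLineMass J x :=
  hJ.setIntegral_nonneg _ x

theorem halfLineMass_le_one (hJ : IsDispersalKernel J) (x : ℝ) : halfLineMass J x ≤ 1 :=
  hJ.setIntegral_le_one _ x

theorem setIntegral_Icc_le_halfLineMass (hJ : IsDispersalKernel J) (x b : ℝ) :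
    ∫ y in Icc 0 b, J (x - y) ≤ halfLineMass J x := by
  rw [integral_Icc_eq_integral_Ioc]
  exact setIntegral_mono_set (hJ.integrable_sub x).integrableOn
    (Eventually.of_forall fun _ => hJ.nonneg _) (Eventually.of_forall Ioc_subset_Ioi_self)

theorem integrableOn_mul_Icc (hJ : IsDispersalKernel J) {g : ℝ → ℝ} {a b : ℝ}
    (hg : ContinuousOn g (Icc a b)) (x : ℝ) :
    IntegrableOn (fun y => J (x - y) * g y) (Icc a b) :=
  ((hJ.continuous.comp (continuous_const.sub continuous_id)).continuousOn.mul hg).integrableOn_Icc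

theorem abs_setIntegral_mul_le (hJ : IsDispersalKernel J) {s : Set ℝ} (hs : MeasurableSet s)
    {g : ℝ → ℝ} {B : ℝ} (hB0 : 0 ≤ B) (hB : ∀ y ∈ s, |g y| ≤ B) (x : ℝ) :
    |∫ y in s, J (x - y) * g y| ≤ B := by
  have h1 : ‖∫ y in s, J (x - y) * g y‖ ≤ ∫ y in s, J (x - y) * B := by
    refine norm_integral_le_of_norm_le ((hJ.integrable_sub x).mul_const B).integrableOn ?_
    refine (ae_restrict_iff' hs).2 (Eventually.of_forall fun y hy => ?_)
    rw [Real.norm_eq_abs, abs_mul, abs_of_nonneg (hJ.nonneg _)]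
    exact mul_le_mul_of_nonneg_left (hB y hy) (hJ.nonneg _)
  rw [integral_mul_const] at h1
  have := hJ.setIntegral_le_one s x
  rw [Real.norm_eq_abs] at h1
  nlinarith

theorem exists_pos_le_near_zero (hJ : IsDispersalKernel J) :
    ∃ c > 0, ∃ r > 0, ∀ z, |z| ≤ r → c ≤ J z := by
  have h1 : ∀ᶠ z in 𝓝 (0 : ℝ), J 0 / 2 < J z :=
    hJ.continuous.continuousAt.eventually_const_lt (half_lt_self hJ.pos_zero)
  obtain ⟨r, hr, h2⟩ := Metric.eventually_nhds_iff.1 h1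
  refine ⟨J 0 / 2, half_pos hJ.pos_zero, r / 2, half_pos hr, fun z hz => (h2 ?_).le⟩
  rw [Real.dist_eq, sub_zero]; linarith

theorem integrable_kernelTail (hJ : IsDispersalKernel J) (ρ : ℝ) : Integrable (kernelTail J ρ) :=
  hJ.integrable.indicator (measurableSet_le measurable_const measurable_norm)

theorem exists_integral_kernelTail_lt (hJ : IsDispersalKernel J) {ε : ℝ} (hε : 0 < ε) :
    ∃ ρ > 0, ∫ z, kernelTail J ρ z < ε := by
  have h1 : Tendsto (fun ρ : ℝ => ∫ z, kernelTail J ρ z) atTop (𝓝 (∫ _ : ℝ, (0 : ℝ))) := by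
    refine tendsto_integral_filter_of_dominated_convergence J
      (Eventually.of_forall fun ρ => (hJ.integrable_kernelTail ρ).aestronglyMeasurable)
      (Eventually.of_forall fun ρ => Eventually.of_forall fun z => ?_) hJ.integrable
      (Eventually.of_forall fun z => ?_)
    · refine (norm_indicator_le_norm_self J z).trans ?_
      rw [Real.norm_eq_abs, abs_of_nonneg (hJ.nonneg z)]
    · refine tendsto_const_nhds.congr' ?_
      filter_upwards [eventually_gt_atTop |z|] with ρ hρ
      rw [kernelTail, indicator_of_notMem]
      simpa using hρ
  rw [integral_zero] at h1
  obtain ⟨ρ, h2, h3⟩ := ((h1.eventually_lt_const hε).and (eventually_gt_atTop 0)).exists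
  exact ⟨ρ, h3, h2⟩

theorem measurable_setIntegral (hJ : IsDispersalKernel J) (s : Set ℝ) :
    Measurable fun x => ∫ y in s, J (x - y) := by
  have h1 : StronglyMeasurable fun p : ℝ × ℝ => J (p.1 - p.2) :=
    (hJ.continuous.comp (continuous_fst.sub continuous_snd)).stronglyMeasurable
  exact h1.integral_prod_right.measurable

theorem integrableOn_flux (hJ : IsDispersalKernel J) {g : ℝ → ℝ} {b : ℝ}
    (hg : ContinuousOn g (Icc 0 b)) :
    IntegrableOn (fun x => ∫ y in Ioi b, J (x - y) * g x) (Icc 0 b) := by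
  simp only [integral_mul_const]
  refine hg.integrableOn_Icc.bdd_mul (c := 1)
    (hJ.measurable_setIntegral _).aestronglyMeasurable (Eventually.of_forall fun x => ?_)
  rw [Real.norm_eq_abs, abs_of_nonneg (hJ.setIntegral_nonneg _ _)]
  exact hJ.setIntegral_le_one _ _

theorem flux_nonneg (hJ : IsDispersalKernel J) {g : ℝ → ℝ} {b : ℝ}
    (hg0 : ∀ x ∈ Icc 0 b, 0 ≤ g x) :
    0 ≤ ∫ x in Icc 0 b, ∫ y in Ioi b, J (x - y) * g x :=
  MeasureTheory.setIntegral_nonneg measurableSet_Icc fun x hx =>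
    integral_nonneg fun _ => mul_nonneg (hJ.nonneg _) (hg0 x hx)

theorem flux_le (hJ : IsDispersalKernel J) {g : ℝ → ℝ} {b M : ℝ} (hb : 0 ≤ b)
    (hg : ContinuousOn g (Icc 0 b)) (hM : 0 ≤ M) (hgM : ∀ x ∈ Icc 0 b, g x ≤ M) :
    ∫ x in Icc 0 b, ∫ y in Ioi b, J (x - y) * g x ≤ M * b := by
  have h1 : ∫ x in Icc 0 b, ∫ y in Ioi b, J (x - y) * g x ≤ ∫ _ in Icc 0 b, M := by
    refine setIntegral_mono_on (hJ.integrableOn_flux hg) (integrableOn_const (by simp))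
      measurableSet_Icc fun x hx => ?_
    rw [integral_mul_const]
    have h2 := hJ.setIntegral_le_one (Ioi b) x
    have h3 := hJ.setIntegral_nonneg (Ioi b) x
    have h4 := hgM x hx
    nlinarith
  have h3 : ∫ _ in Icc 0 b, M = M * b := by
    simp [Measure.real, hb, mul_comm]
  linarith

/-- Only jumps from `[p, p + s]` to `[b, b + s]` are counted. They have length at most `b - p + s ≤
r`, so `J ≥ c₀` there; the two intervals contribute the factor `s ^ 2`. -/
theorem le_flux (hJ : IsDispersalKernel J) {g : ℝ → ℝ} {b c₀ r s p m : ℝ}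
    (hr : ∀ z, |z| ≤ r → c₀ ≤ J z) (hs : 0 < s)
    (hg : ContinuousOn g (Icc 0 b)) (hg0 : ∀ x ∈ Icc 0 b, 0 ≤ g x) (hm0 : 0 ≤ m)
    (hp0 : 0 ≤ p) (hpb : p + s ≤ b) (hbp : b - p + s ≤ r) (hm : ∀ x ∈ Icc p (p + s), m ≤ g x) :
    c₀ * m * s ^ 2 ≤ ∫ x in Icc 0 b, ∫ y in Ioi b, J (x - y) * g x := by
  have h1 := mul_sub_le_setIntegral (p := p) (q := p + s) (m := c₀ * m * s)
    measurableSet_Icc (hJ.integrableOn_flux hg)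
    (fun x hx => integral_nonneg fun _ => mul_nonneg (hJ.nonneg _) (hg0 x hx))
    (by linarith) (Icc_subset_Icc hp0 hpb) (fun x hx => ?_)
  · calc c₀ * m * s ^ 2 = c₀ * m * s * (p + s - p) := by ring
      _ ≤ _ := h1
  · have hgx := hm x hx
    have h2 := mul_sub_le_setIntegral (A := Ici b) (p := b) (q := b + s) (m := c₀ * m)
      measurableSet_Ici ((hJ.integrable_sub x).mul_const (g x)).integrableOn
      (fun y _ => mul_nonneg (hJ.nonneg _) (hm0.trans hgx)) (by linarith)
      (fun y hy => hy.1) (fun y hy => ?_)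
    · rw [integral_Ici_eq_integral_Ioi] at h2
      calc c₀ * m * s = c₀ * m * (b + s - b) := by ring
        _ ≤ _ := h2
    · refine mul_le_mul (hr _ ?_) hgx hm0 (hJ.nonneg _)
      rw [abs_le]
      constructor <;> linarith [hx.1, hx.2, hy.1, hy.2]

end IsDispersalKernel

/-! ### Maximum principle and Grönwall iteration -/

/-- Maximum principle: if `w` is nonnegative initially and, at every negative spatial minimum that
can be approached from earlier times, `w_t ≥ C w`, then `w` is nonnegative. -/
theorem nonneg_of_hasDerivAt_ge {D : Set (ℝ × ℝ)} (hD : IsCompact D)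
    {w : ℝ → ℝ → ℝ} (hw : ContinuousOn (fun p : ℝ × ℝ => w p.1 p.2) D) {C : ℝ}
    (hD0 : ∀ t x, (t, x) ∈ D → 0 ≤ t) (h0 : ∀ x, (0, x) ∈ D → 0 ≤ w 0 x)
    (hstep : ∀ t x, (t, x) ∈ D → 0 < t → w t x < 0 → (∀ y, (t, y) ∈ D → w t x ≤ w t y) →
      (∀ᶠ s in 𝓝[<] t, (s, x) ∈ D) ∧
        ∃ w', HasDerivAt (fun s => w s x) w' t ∧ C * w t x ≤ w') :
    ∀ t x, (t, x) ∈ D → 0 ≤ w t x := by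
  intro t₁ x₁ h₁
  -- Any `k > C` makes `ε exp(kt)` a strict perturbation: at a first zero, `w = -ε exp(kt)` and the
  -- slope is at least `(k - C) ε exp(kt) > 0`, whereas arrival from positive values needs slope `≤
  -- 0`.
  set k := |C| + 1 with hk
  suffices H : ∀ ε > 0, 0 < w t₁ x₁ + ε * Real.exp (k * t₁) by
    by_contra! hneg
    have := H (-w t₁ x₁ / Real.exp (k * t₁)) (div_pos (by linarith) (Real.exp_pos _))
    rw [div_mul_cancel₀ _ (Real.exp_pos _).ne'] at this
    linarith
  intro ε hε
  by_contra! hneg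
  have hcont : ContinuousOn (fun p : ℝ × ℝ => w p.1 p.2 + ε * Real.exp (k * p.1)) D :=
    hw.add (by fun_prop)
  set Z : Set (ℝ × ℝ) := D ∩ (fun p : ℝ × ℝ => w p.1 p.2 + ε * Real.exp (k * p.1)) ⁻¹' Iic 0
  have hZ : IsCompact Z :=
    hD.of_isClosed_subset (hcont.preimage_isClosed_of_isClosed hD.isClosed isClosed_Iic)
      inter_subset_left
  obtain ⟨⟨t, x₀⟩, ⟨htD, htw⟩, hmin⟩ :=
    hZ.exists_isMinOn ⟨(t₁, x₁), h₁, hneg⟩ continuous_fst.continuousOn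
  have hslice : IsCompact (D ∩ {p | p.1 = t}) :=
    hD.inter_right (isClosed_eq continuous_fst continuous_const)
  -- At the first bad time, pass to the spatial minimum of `w`, where `hstep` applies; the perturbed
  -- function is still `≤ 0` there.
  obtain ⟨⟨t', x⟩, ⟨hxD, ht'⟩, hxmin⟩ :=
    hslice.exists_isMinOn ⟨(t, x₀), htD, rfl⟩ (hw.mono inter_subset_left)
  obtain rfl : t' = t := ht'
  have hle : w t' x ≤ w t' x₀ := hxmin ⟨htD, rfl⟩
  have hexp : 0 < ε * Real.exp (k * t') := mul_pos hε (Real.exp_pos _)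
  have htw' : w t' x₀ + ε * Real.exp (k * t') ≤ 0 := htw
  have hwneg : w t' x < 0 := by linarith
  have ht0 : 0 < t' := by
    rcases (hD0 _ _ hxD).eq_or_lt with h | h
    · subst h; linarith [h0 x hxD]
    · exact h
  obtain ⟨hev, w', hder, hw'⟩ := hstep t' x hxD ht0 hwneg fun y hy => hxmin ⟨hy, rfl⟩
  have hder2 : HasDerivAt (fun s => w s x + ε * Real.exp (k * s))
      (w' + ε * (Real.exp (k * t') * (k * 1))) t' :=
    hder.add ((((hasDerivAt_id t').const_mul k).exp).const_mul ε)
  have hpos : ∀ᶠ s in 𝓝[<] t', 0 < w s x + ε * Real.exp (k * s) := by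
    filter_upwards [hev, self_mem_nhdsWithin] with s hs hst
    by_contra! hle
    have : t' ≤ s := hmin (show (s, x) ∈ Z from ⟨hs, hle⟩)
    exact absurd hst (not_lt.2 this)
  have hge : 0 ≤ w t' x + ε * Real.exp (k * t') :=
    ge_of_tendsto (hder2.continuousAt.tendsto.mono_left nhdsWithin_le_nhds)
      (hpos.mono fun _ h => h.le)
  have hval : w t' x = -(ε * Real.exp (k * t')) := by linarith
  have hslope : w' + ε * (Real.exp (k * t') * (k * 1)) ≤ 0 := by
    refine le_of_tendsto (hasDerivWithinAt_iff_tendsto_slope'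
      (notMem_Iio.2 le_rfl) |>.1 (hder2.hasDerivWithinAt (s := Iio t'))) ?_
    filter_upwards [hpos, self_mem_nhdsWithin] with s hs hst
    rw [slope_def_field]
    refine div_nonpos_of_nonneg_of_nonpos ?_ (sub_nonpos.2 (le_of_lt hst))
    linarith
  rw [hval] at hw'
  have : C ≤ |C| := le_abs_self C
  nlinarith

/-- A Grönwall estimate on a decreasing sequence of sets: the rate of change on `S (n + 1)` is
controlled by the size on `S n`. -/
theorem abs_le_of_abs_deriv_le_nested {X : Type*} {S : ℕ → Set X} {w w' : ℝ → X → ℝ}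
    {a b K L E ε : ℝ} (hE : 0 ≤ E)
    (hS : ∀ n, S (n + 1) ⊆ S n)
    (hcont : ∀ x ∈ S 0, ContinuousOn (fun t => w t x) (Icc a b))
    (hder : ∀ t ∈ Ioo a b, ∀ x ∈ S 0, HasDerivAt (fun s => w s x) (w' t x) t)
    (hinit : ∀ x ∈ S 0, |w a x| ≤ ε) (hK : ∀ t ∈ Icc a b, ∀ x ∈ S 0, |w t x| ≤ K)
    (hstep : ∀ n, ∀ t ∈ Ioo a b, ∀ B, (∀ y ∈ S n, |w t y| ≤ B) →
      ∀ x ∈ S (n + 1), |w' t x| ≤ L * B + E) (n : ℕ) :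
    ∀ t ∈ Icc a b, ∀ x ∈ S n,
      |w t x| ≤ K * ((L * (t - a)) ^ n / n.factorial) + (ε + E * (b - a)) * Real.exp (L * (t - a)) := by
  have hS0 : ∀ n, S n ⊆ S 0 := fun n => by
    induction n with
    | zero => exact Subset.rfl
    | succ n ih => exact (hS n).trans ih
  induction n with
  | zero =>
    intro t ht x hx
    have hε : 0 ≤ ε := (abs_nonneg _).trans (hinit x hx)
    have : 0 ≤ (ε + E * (b - a)) * Real.exp (L * (t - a)) :=
      mul_nonneg (add_nonneg hε (mul_nonneg hE (by linarith [ht.1, ht.2]))) (Real.exp_pos _).le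
    simpa using (hK t ht x hx).trans (by linarith)
  | succ n ih =>
    intro t ht x hx
    have hx0 := hS0 _ hx
    have hε : 0 ≤ ε := (abs_nonneg _).trans (hinit x hx0)
    have hab : a ≤ b := ht.1.trans ht.2
    set A := ε + E * (b - a)
    have hA : 0 ≤ A := add_nonneg hε (mul_nonneg hE (by linarith))
    -- `G` is the integral from `a` of `L` times the bound on `S n`, plus `E`. Its term `-A` pays
    -- for the initial error `ε` and for `E * (t - a)`, so the bound reproduces itself with `n + 1`.
    set G : ℝ → ℝ := fun t => K * ((L * (t - a)) ^ (n + 1) / (n + 1).factorial)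
      + A * (Real.exp (L * (t - a)) - 1) + E * (t - a)
    have hG : ∀ s, HasDerivAt G (L * (K * ((L * (s - a)) ^ n / n.factorial)
        + A * Real.exp (L * (s - a))) + E) s := by
      intro s
      have h1 : HasDerivAt (fun s => L * (s - a)) L s := by
        simpa using ((hasDerivAt_id s).sub_const a).const_mul L
      have h2 := ((((h1.pow (n + 1)).div_const ((n + 1).factorial : ℝ)).const_mul K).add
        ((h1.exp.sub_const 1).const_mul A)).add (((hasDerivAt_id s).sub_const a).const_mul E)
      refine h2.congr_deriv ?_
      have : ((n + 1).factorial : ℝ) = (n + 1) * n.factorial := by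
        rw [Nat.factorial_succ]; push_cast; ring
      have hn : (n.factorial : ℝ) ≠ 0 := by positivity
      have hn1 : (n : ℝ) + 1 ≠ 0 := by positivity
      rw [this]
      push_cast
      field_simp
    have key : |w t x| ≤ |w a x| + G t := by
      -- Comparing `G` with `σ w` for `σ = ±1` avoids differentiating the absolute value.
      have h3 : ∀ σ : ℝ, |σ| = 1 → σ * w t x - σ * w a x ≤ G t := by
        intro σ hσ
        have hd : ∀ s ∈ Ioo a b, HasDerivAt (fun s => G s - σ * w s x) _ s :=
          fun s hs => (hG s).sub ((hder s hs x hx0).const_mul σ)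
        have hGc : ContinuousOn G (Icc a b) :=
          fun s _ => (hG s).continuousAt.continuousWithinAt
        have hmono : MonotoneOn (fun s => G s - σ * w s x) (Icc a b) := by
          refine monotoneOn_of_deriv_nonneg (convex_Icc a b)
            (hGc.sub (continuousOn_const.mul (hcont x hx0))) ?_ ?_
          · rw [interior_Icc]
            intro s hs
            exact (hd s hs).differentiableAt.differentiableWithinAt
          · rw [interior_Icc]
            intro s hs
            rw [(hd s hs).deriv]
            have h4 := hstep n s hs _ (ih s (Ioo_subset_Icc_self hs)) x hx
            have h5 : σ * w' s x ≤ |w' s x| := by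
              calc σ * w' s x ≤ |σ * w' s x| := le_abs_self _
                _ = |w' s x| := by rw [abs_mul, hσ, one_mul]
            linarith
        have h6 := hmono (left_mem_Icc.2 hab) ht ht.1
        have h7 : G a = 0 := by simp [G]
        simp only [h7] at h6
        linarith
      have h8 := h3 1 (by simp)
      have h9 := h3 (-1) (by simp)
      have := abs_le.1 (le_refl |w a x|)
      rw [abs_le]
      constructor <;> linarith
    have h10 := hinit x hx0
    have h11 : E * (t - a) ≤ E * (b - a) := mul_le_mul_of_nonneg_left (by linarith [ht.2]) hE
    have h12 : G t = K * ((L * (t - a)) ^ (n + 1) / (n + 1).factorial)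
      + A * (Real.exp (L * (t - a)) - 1) + E * (t - a) := rfl
    have h13 : A = ε + E * (b - a) := rfl
    linarith

/-! ### Growth term and initial datum -/

namespace IsMonostable

variable {f : ℝ → ℝ}

theorem exists_lipschitz (hf : IsMonostable f) (K : ℝ) :
    ∃ L, 0 ≤ L ∧ ∀ a b, |a| ≤ K → |b| ≤ K → |f a - f b| ≤ L * |a - b| := by
  obtain ⟨L, hL⟩ := isCompact_Icc.exists_bound_of_continuousOn
    (hf.contDiff.continuous_deriv le_rfl).continuousOn (s := Icc (-K) K)
  refine ⟨max L 0, le_max_right _ _, fun a b ha hb => ?_⟩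
  exact (convex_Icc (-K) K).norm_image_sub_le_of_norm_deriv_le
    (fun x _ => (hf.contDiff.differentiable one_ne_zero).differentiableAt)
    (fun x hx => (hL x hx).trans (le_max_left _ _)) (abs_le.1 hb) (abs_le.1 ha)

theorem exists_nonpos (hf : IsMonostable f) : ∃ m, 0 < m ∧ ∀ s, m ≤ s → f s ≤ 0 := by
  obtain ⟨m, hm, hfm, -⟩ := hf.exists_pos_zero
  refine ⟨m, hm, fun s hs => ?_⟩
  have h1 : f s / s ≤ f m / m :=
    hf.strictAntiOn_div.antitoneOn (mem_Ioi.2 hm) (mem_Ioi.2 (hm.trans_le hs)) hs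
  rw [hfm, zero_div, div_le_iff₀ (hm.trans_le hs), zero_mul] at h1
  exact h1

end IsMonostable

/-- `M` is a constant supersolution lying above the initial datum. -/
structure IsUpperBound (h₀ : ℝ) (f u₀ : ℝ → ℝ) (M : ℝ) : Prop where
  pos : 0 < M
  datum_le : ∀ x ∈ Icc 0 h₀, u₀ x ≤ M
  nonpos : ∀ s, M ≤ s → f s ≤ 0

theorem IsInitialDatum.exists_isUpperBound {h₀ : ℝ} {f u₀ : ℝ → ℝ} (hu₀ : IsInitialDatum h₀ u₀)
    (hf : IsMonostable f) : ∃ M, IsUpperBound h₀ f u₀ M := by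
  obtain ⟨m, hm, h1⟩ := hf.exists_nonpos
  obtain ⟨C, hC⟩ := isCompact_Icc.exists_bound_of_continuousOn hu₀.continuousOn
  exact ⟨max m C, hm.trans_le (le_max_left _ _),
    fun x hx => ((le_abs_self _).trans (hC x hx)).trans (le_max_right _ _),
    fun s hs => h1 s ((le_max_left _ _).trans hs)⟩

theorem IsInitialDatum.nonneg {h₀ : ℝ} {u₀ : ℝ → ℝ} (hu₀ : IsInitialDatum h₀ u₀) :
    ∀ x ∈ Icc 0 h₀, 0 ≤ u₀ x := fun x hx => by
  rcases hx.2.eq_or_lt with h | h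
  · rw [h, hu₀.end_eq_zero]
  · exact (hu₀.pos x ⟨hx.1, h⟩).le

/-! ### A priori bounds for the free boundary problem -/

namespace IsFreeBoundarySolution

variable {d μ h₀ : ℝ} {J f u₀ : ℝ → ℝ} {u : ℝ → ℝ → ℝ} {h : ℝ → ℝ}

theorem isCompact_domain (hs : IsFreeBoundarySolution d μ h₀ J f u₀ u h) (T : ℝ) :
    IsCompact {p : ℝ × ℝ | p.1 ∈ Icc 0 T ∧ 0 ≤ p.2 ∧ p.2 ≤ h p.1} := by
  have hc : ContinuousOn h (Icc 0 T) := hs.continuousOn_h.mono Icc_subset_Ici_self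
  obtain ⟨R, hR⟩ := isCompact_Icc.exists_bound_of_continuousOn hc
  have hK : IsCompact (Icc 0 T ×ˢ Icc 0 R) := isCompact_Icc.prod isCompact_Icc
  have hg : ContinuousOn (fun p : ℝ × ℝ => h p.1 - p.2) (Icc 0 T ×ˢ Icc 0 R) :=
    (hc.comp continuousOn_fst fun p hp => hp.1).sub continuousOn_snd
  refine (hK.of_isClosed_subset
    (hg.preimage_isClosed_of_isClosed hK.isClosed (isClosed_Ici (a := (0 : ℝ))))
    inter_subset_left).of_isClosed_subset ?_ ?_ (s := _)
  · convert hg.preimage_isClosed_of_isClosed hK.isClosed (isClosed_Ici (a := (0 : ℝ))) using 1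
    ext p
    simp only [mem_ofPred_eq, mem_inter_iff, mem_prod, mem_preimage, mem_Ici, sub_nonneg]
    constructor
    · rintro ⟨h1, h2, h3⟩
      exact ⟨⟨h1, h2, h3.trans ((le_abs_self _).trans (hR _ h1))⟩, h3⟩
    · rintro ⟨⟨h1, h2⟩, h3⟩
      exact ⟨h1, h2.1, h3⟩
  · rintro p ⟨h1, h2, h3⟩
    exact ⟨⟨h1, h2, h3.trans ((le_abs_self _).trans (hR _ h1))⟩, sub_nonneg.2 h3⟩

theorem continuousOn_slice (hs : IsFreeBoundarySolution d μ h₀ J f u₀ u h) {t : ℝ} (ht : 0 ≤ t) :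
    ContinuousOn (u t) (Icc 0 (h t)) :=
  hs.continuousOn_u.comp (continuousOn_const.prodMk continuousOn_id) fun _ hx => ⟨ht, hx.1, hx.2⟩

theorem continuousOn_time (hs : IsFreeBoundarySolution d μ h₀ J f u₀ u h) {a b x : ℝ}
    (ha : 0 ≤ a) (hx : 0 ≤ x) (hxh : ∀ s ∈ Icc a b, x ≤ h s) :
    ContinuousOn (fun s => u s x) (Icc a b) :=
  hs.continuousOn_u.comp (continuousOn_id.prodMk continuousOn_const) fun s hs' =>
    ⟨ha.trans hs'.1, hx, hxh s hs'⟩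

theorem eventually_mem_domain (hs : IsFreeBoundarySolution d μ h₀ J f u₀ u h) {T t x : ℝ}
    (ht : t ∈ Icc 0 T) (ht0 : 0 < t) (hx : 0 ≤ x) (hxh : x < h t) :
    ∀ᶠ s in 𝓝[<] t, (s, x) ∈ {p : ℝ × ℝ | p.1 ∈ Icc 0 T ∧ 0 ≤ p.2 ∧ p.2 ≤ h p.1} := by
  have h1 : ContinuousAt h t := (hs.eq_h t ht0).continuousAt
  filter_upwards [nhdsWithin_le_nhds (h1.eventually_const_lt hxh),
    nhdsWithin_le_nhds (Ioi_mem_nhds ht0), self_mem_nhdsWithin] with s h2 h3 h4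
  exact ⟨⟨le_of_lt h3, (le_of_lt h4).trans ht.2⟩, hx, h2.le⟩

/-- A negative minimum lies off the front, where `u = 0`. Since the mass of `J` is at most one, the
integral there is at least `u`; the loss term helps, and `f(u) ≥ L u`. So `u_t ≥ (d + L) u`. -/
theorem nonneg (hs : IsFreeBoundarySolution d μ h₀ J f u₀ u h) (hd : 0 < d)
    (hJ : IsDispersalKernel J) (hf : IsMonostable f) (hu₀ : IsInitialDatum h₀ u₀)
    {t x : ℝ} (ht : 0 ≤ t) (hx : x ∈ Icc 0 (h t)) : 0 ≤ u t x := by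
  have hD := hs.isCompact_domain t
  have hw : ContinuousOn (fun p : ℝ × ℝ => u p.1 p.2)
      {p : ℝ × ℝ | p.1 ∈ Icc 0 t ∧ 0 ≤ p.2 ∧ p.2 ≤ h p.1} :=
    hs.continuousOn_u.mono fun p hp => ⟨hp.1.1, hp.2⟩
  obtain ⟨K, hK⟩ := hD.exists_bound_of_continuousOn hw
  obtain ⟨L, hL0, hL⟩ := hf.exists_lipschitz K
  refine nonneg_of_hasDerivAt_ge hD hw (C := d + L) (fun s y h1 => h1.1.1) (fun y hy => ?_) ?_ t x
    ⟨⟨ht, le_rfl⟩, hx.1, hx.2⟩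
  · have hy' : y ∈ Icc 0 h₀ := ⟨hy.2.1, hs.init_h ▸ hy.2.2⟩
    rw [hs.init_u y hy']
    exact hu₀.nonneg y hy'
  · intro s y hy hs0 hneg hmin
    have hys : y < h s := hy.2.2.lt_of_ne fun he => by
      change y = h s at he
      rw [he, hs.boundary s hs0] at hneg
      exact hneg.false
    refine ⟨hs.eventually_mem_domain hy.1 hs0 hy.2.1 hys, _, hs.eq_u s y hs0 hy.2.1 hys, ?_⟩
    have h1 : u s y ≤ ∫ z in Icc 0 (h s), J (y - z) * u s z := by
      have h2 : ∫ z in Icc 0 (h s), J (y - z) * u s y ≤ ∫ z in Icc 0 (h s), J (y - z) * u s z :=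
        setIntegral_mono_on ((hJ.integrable_sub y).mul_const _).integrableOn
          (hJ.integrableOn_mul_Icc (hs.continuousOn_slice hs0.le) y) measurableSet_Icc
          fun z hz => mul_le_mul_of_nonneg_left (hmin z ⟨hy.1, hz.1, hz.2⟩) (hJ.nonneg _)
      rw [integral_mul_const] at h2
      have h3 := hJ.setIntegral_le_one (Icc 0 (h s)) y
      nlinarith
    have hKy : |u s y| ≤ K := hK (s, y) hy
    have h4 := hL (u s y) 0 hKy (by simpa using (abs_nonneg _).trans hKy)
    rw [hf.zero, sub_zero, sub_zero, abs_of_neg hneg] at h4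
    have h5 := neg_abs_le (f (u s y))
    have h6 := hJ.halfLineMass_nonneg y
    have h7 : 0 ≤ d * halfLineMass J y * -u s y := by
      have : 0 ≤ -u s y := by linarith
      positivity
    have h8 := mul_le_mul_of_nonneg_left h1 hd.le
    linarith

/-- At a spatial maximum above `M`, dispersal gains at most `j u`, which the loss term cancels, and
`f(u) ≤ 0`. The maximum principle applies to `M - u` with `C = 0`. -/
theorem le_of_isUpperBound (hs : IsFreeBoundarySolution d μ h₀ J f u₀ u h) (hd : 0 < d)
    (hJ : IsDispersalKernel J) {M : ℝ} (hM : IsUpperBound h₀ f u₀ M)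
    {t x : ℝ} (ht : 0 ≤ t) (hx : x ∈ Icc 0 (h t)) : u t x ≤ M := by
  have hD := hs.isCompact_domain t
  have hw : ContinuousOn (fun p : ℝ × ℝ => M - u p.1 p.2)
      {p : ℝ × ℝ | p.1 ∈ Icc 0 t ∧ 0 ≤ p.2 ∧ p.2 ≤ h p.1} :=
    continuousOn_const.sub (hs.continuousOn_u.mono fun p hp => ⟨hp.1.1, hp.2⟩)
  refine sub_nonneg.1 (nonneg_of_hasDerivAt_ge hD (w := fun t x => M - u t x) hw (C := 0)
    (fun s y h1 => h1.1.1) (fun y hy => ?_) ?_ t x ⟨⟨ht, le_rfl⟩, hx.1, hx.2⟩)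
  · have hy' : y ∈ Icc 0 h₀ := ⟨hy.2.1, hs.init_h ▸ hy.2.2⟩
    rw [hs.init_u y hy']
    exact sub_nonneg.2 (hM.datum_le y hy')
  · intro s y hy hs0 hneg hmin
    have hMpos := hM.pos
    have hys : y < h s := hy.2.2.lt_of_ne fun he => by
      change y = h s at he
      rw [he, hs.boundary s hs0] at hneg
      linarith
    refine ⟨hs.eventually_mem_domain hy.1 hs0 hy.2.1 hys, _,
      (hs.eq_u s y hs0 hy.2.1 hys).const_sub M, ?_⟩
    have h1 : ∫ z in Icc 0 (h s), J (y - z) * u s z ≤ halfLineMass J y * u s y := by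
      have h2 : ∫ z in Icc 0 (h s), J (y - z) * u s z ≤ ∫ z in Icc 0 (h s), J (y - z) * u s y :=
        setIntegral_mono_on (hJ.integrableOn_mul_Icc (hs.continuousOn_slice hs0.le) y)
          ((hJ.integrable_sub y).mul_const _).integrableOn measurableSet_Icc
          fun z hz => mul_le_mul_of_nonneg_left
            (by linarith [hmin z ⟨hy.1, hz.1, hz.2⟩]) (hJ.nonneg _)
      rw [integral_mul_const] at h2
      exact h2.trans (mul_le_mul_of_nonneg_right (hJ.setIntegral_Icc_le_halfLineMass y _)
        (by linarith))
    have h3 := hM.nonpos (u s y) (by linarith)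
    have h4 := mul_le_mul_of_nonneg_left h1 hd.le
    linarith

theorem monotoneOn (hs : IsFreeBoundarySolution d μ h₀ J f u₀ u h) (hd : 0 < d) (hμ : 0 < μ)
    (hJ : IsDispersalKernel J) (hf : IsMonostable f) (hu₀ : IsInitialDatum h₀ u₀) :
    MonotoneOn h (Ici 0) := by
  refine monotoneOn_of_deriv_nonneg (convex_Ici 0) hs.continuousOn_h ?_ ?_ <;> rw [interior_Ici]
  · exact fun t ht => (hs.eq_h t ht).differentiableAt.differentiableWithinAt
  · intro t ht
    rw [(hs.eq_h t ht).deriv]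
    exact mul_nonneg hμ.le (hJ.flux_nonneg fun x hx => hs.nonneg hd hJ hf hu₀ (le_of_lt ht) hx)

theorem le_h (hs : IsFreeBoundarySolution d μ h₀ J f u₀ u h) (hd : 0 < d) (hμ : 0 < μ)
    (hJ : IsDispersalKernel J) (hf : IsMonostable f) (hu₀ : IsInitialDatum h₀ u₀) {t : ℝ}
    (ht : 0 ≤ t) : h₀ ≤ h t :=
  hs.init_h ▸ hs.monotoneOn hd hμ hJ hf hu₀ (mem_Ici.2 le_rfl) (mem_Ici.2 ht) ht

/-- The integrating factor `exp((d + L)(s - a))` absorbs loss and reaction, so the product with `u`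
grows at rate at least `κ`. The choice `κ = 0` propagates the datum; `κ > 0` creates mass where `u`
may have vanished. -/
theorem exp_mul_le (hs : IsFreeBoundarySolution d μ h₀ J f u₀ u h) (hd : 0 < d)
    (hJ : IsDispersalKernel J) (hf : IsMonostable f) (hu₀ : IsInitialDatum h₀ u₀)
    {M L : ℝ} (hM : IsUpperBound h₀ f u₀ M) (hL0 : 0 ≤ L)
    (hL : ∀ a b, |a| ≤ M → |b| ≤ M → |f a - f b| ≤ L * |a - b|)
    {a b x κ : ℝ} (ha : 0 ≤ a) (hab : a ≤ b) (hx : 0 ≤ x) (hxa : x ≤ h a)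
    (hxh : ∀ s ∈ Ioc a b, x < h s) (hκ : 0 ≤ κ)
    (hint : ∀ s ∈ Ioo a b, κ ≤ d * ∫ y in Icc 0 (h s), J (x - y) * u s y) :
    Real.exp (-((d + L) * (b - a))) * (u a x + κ * (b - a)) ≤ u b x := by
  have hd' : ∀ s ∈ Ioo a b, HasDerivAt
      (fun s => Real.exp ((d + L) * (s - a)) * u s x - κ * s) _ s := fun s h1 =>
    (((((hasDerivAt_id s).sub_const a).const_mul (d + L)).exp).mul
      (hs.eq_u s x (ha.trans_lt h1.1) hx (hxh s ⟨h1.1, h1.2.le⟩))).sub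
      ((hasDerivAt_id s).const_mul κ)
  have hmono : MonotoneOn (fun s => Real.exp ((d + L) * (s - a)) * u s x - κ * s) (Icc a b) := by
    refine monotoneOn_of_deriv_nonneg (convex_Icc a b) ?_ ?_ ?_
    · refine ((by fun_prop : Continuous fun s => Real.exp ((d + L) * (s - a))).continuousOn.mul
        (hs.continuousOn_time ha hx fun s h1 => ?_)).sub (by fun_prop)
      rcases h1.1.eq_or_lt with h2 | h2
      · exact h2 ▸ hxa
      · exact (hxh s ⟨h2, h1.2⟩).le
    · rw [interior_Icc]
      exact fun s h1 => (hd' s h1).differentiableAt.differentiableWithinAt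
    · rw [interior_Icc]
      intro s h1
      rw [(hd' s h1).deriv]
      have hs0 : 0 ≤ s := ha.trans h1.1.le
      have hxs : x ∈ Icc 0 (h s) := ⟨hx, (hxh s ⟨h1.1, h1.2.le⟩).le⟩
      have h2 := hs.nonneg hd hJ hf hu₀ hs0 hxs
      have h3 := hs.le_of_isUpperBound hd hJ hM hs0 hxs
      have h4 := hL (u s x) 0 (by rwa [abs_of_nonneg h2]) (by simpa using hM.pos.le)
      rw [hf.zero, sub_zero, sub_zero, abs_of_nonneg h2] at h4
      have h5 := (abs_le.1 h4).1
      have h6 := hint s h1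
      have h7 : d * halfLineMass J x * u s x ≤ d * u s x :=
        mul_le_mul_of_nonneg_right (by nlinarith [hJ.halfLineMass_le_one x]) h2
      have h8 : 1 ≤ Real.exp ((d + L) * (s - a)) :=
        Real.one_le_exp (mul_nonneg (by linarith) (by linarith [h1.1]))
      simp only [id]
      nlinarith
  have h1 := hmono (left_mem_Icc.2 hab) (right_mem_Icc.2 hab) hab
  simp only [sub_self, mul_zero, Real.exp_zero, one_mul] at h1
  rw [Real.exp_neg, inv_mul_le_iff₀ (Real.exp_pos _)]
  linarith

theorem exp_mul_datum_le (hs : IsFreeBoundarySolution d μ h₀ J f u₀ u h) (hd : 0 < d) (hμ : 0 < μ)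
    (hJ : IsDispersalKernel J) (hf : IsMonostable f) (hu₀ : IsInitialDatum h₀ u₀)
    {M L : ℝ} (hM : IsUpperBound h₀ f u₀ M) (hL0 : 0 ≤ L)
    (hL : ∀ a b, |a| ≤ M → |b| ≤ M → |f a - f b| ≤ L * |a - b|)
    {t x : ℝ} (ht : 0 ≤ t) (hx : x ∈ Ico 0 h₀) :
    Real.exp (-((d + L) * t)) * u₀ x ≤ u t x := by
  have h1 := hs.exp_mul_le hd hJ hf hu₀ hM hL0 hL le_rfl ht hx.1 (hs.init_h ▸ hx.2.le)
    (fun s h2 => hx.2.trans_le (hs.le_h hd hμ hJ hf hu₀ h2.1.le)) le_rfl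
    (fun s h2 => mul_nonneg hd.le (setIntegral_nonneg measurableSet_Icc fun y hy =>
      mul_nonneg (hJ.nonneg _) (hs.nonneg hd hJ hf hu₀ h2.1.le hy)))
  rwa [zero_mul, add_zero, sub_zero, hs.init_u x ⟨hx.1, hx.2.le⟩] at h1

/-- Strictness matters because the equation for `u` is posed only for `x < h t`: it makes the
equation available at `x = h₀` for every positive time. A front at rest would contradict the
positive flux produced by `u₀`. -/
theorem lt_h (hs : IsFreeBoundarySolution d μ h₀ J f u₀ u h) (hd : 0 < d) (hμ : 0 < μ)
    (hh₀ : 0 < h₀) (hJ : IsDispersalKernel J) (hf : IsMonostable f) (hu₀ : IsInitialDatum h₀ u₀)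
    {t : ℝ} (ht : 0 < t) : h₀ < h t := by
  obtain ⟨M, hM⟩ := hu₀.exists_isUpperBound hf
  obtain ⟨L, hL0, hL⟩ := hf.exists_lipschitz M
  refine (hs.le_h hd hμ hJ hf hu₀ ht.le).lt_of_ne fun heq => ?_
  have hconst : ∀ s ∈ Icc 0 t, h s = h₀ := fun s h1 =>
    le_antisymm (heq ▸ hs.monotoneOn hd hμ hJ hf hu₀ h1.1 ht.le h1.2)
      (hs.le_h hd hμ hJ hf hu₀ h1.1)
  have ht2 : 0 < t / 2 := half_pos ht
  have hder : deriv h (t / 2) = 0 := by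
    have : h =ᶠ[𝓝 (t / 2)] fun _ => h₀ := by
      filter_upwards [Ioo_mem_nhds ht2 (half_lt_self ht)] with s h1
      exact hconst s (Ioo_subset_Icc_self h1)
    rw [this.deriv_eq, deriv_const]
  rw [(hs.eq_h _ ht2).deriv, hconst (t / 2) ⟨ht2.le, (half_lt_self ht).le⟩] at hder
  obtain ⟨c, hc, r, hr, hJr⟩ := hJ.exists_pos_le_near_zero
  -- The strip `[h₀ - 2s, h₀ - s]` stays off `h₀`, where `u₀` vanishes. `s ≤ h₀ / 2` keeps it in the
  -- domain; jumps from it to `[h₀, h₀ + s]` have length at most `3s ≤ r`.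
  set s := min (r / 3) (h₀ / 2) with hs_def
  have hs1 : s ≤ r / 3 := min_le_left _ _
  have hs2 : s ≤ h₀ / 2 := min_le_right _ _
  have hs0 : 0 < s := lt_min (by linarith) (by linarith)
  obtain ⟨x₁, hx₁, hmin⟩ := isCompact_Icc.exists_isMinOn
    (nonempty_Icc.2 (by linarith : h₀ - 2 * s ≤ h₀ - 2 * s + s))
    (hu₀.continuousOn.mono (Icc_subset_Icc (by linarith) (by linarith)))
  have hx₁0 : 0 < u₀ x₁ := hu₀.pos x₁ ⟨by linarith [hx₁.1], by linarith [hx₁.2]⟩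
  have he := Real.exp_pos (-((d + L) * (t / 2)))
  have hsl := hconst (t / 2) ⟨ht2.le, (half_lt_self ht).le⟩
  have h2 := hJ.le_flux (g := u (t / 2)) (b := h₀) (p := h₀ - 2 * s)
    (m := Real.exp (-((d + L) * (t / 2))) * u₀ x₁) hJr hs0
    (hsl ▸ hs.continuousOn_slice ht2.le)
    (fun x hx => hs.nonneg hd hJ hf hu₀ ht2.le (hsl.symm ▸ hx)) (by positivity)
    (by linarith) (by linarith) (by linarith) (fun x hx => ?_)
  · have h3 : 0 < c * (Real.exp (-((d + L) * (t / 2))) * u₀ x₁) * s ^ 2 := by positivity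
    have h4 := mul_pos hμ (h3.trans_le h2)
    linarith
  · have hx' : x ∈ Ico 0 h₀ := ⟨by linarith [hx.1], by linarith [hx.2]⟩
    exact (mul_le_mul_of_nonneg_left (hmin hx) he.le).trans
      (hs.exp_mul_datum_le hd hμ hJ hf hu₀ hM hL0 hL ht2.le hx')

/-- The flux is at most `M * h`, so `h * exp(-μMt)` is nonincreasing. -/
theorem h_le_exp (hs : IsFreeBoundarySolution d μ h₀ J f u₀ u h) (hd : 0 < d) (hμ : 0 < μ)
    (hh₀ : 0 < h₀) (hJ : IsDispersalKernel J) (hf : IsMonostable f) (hu₀ : IsInitialDatum h₀ u₀)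
    {M : ℝ} (hM : IsUpperBound h₀ f u₀ M) {t : ℝ} (ht : 0 ≤ t) :
    h t ≤ h₀ * Real.exp (μ * M * t) := by
  have hd' : ∀ s ∈ Ioi (0 : ℝ), HasDerivAt (fun s => h s * Real.exp (-(μ * M * s))) _ s :=
    fun s h1 => (hs.eq_h s h1).mul (((hasDerivAt_id s).const_mul (μ * M)).neg.exp)
  have hanti : AntitoneOn (fun s => h s * Real.exp (-(μ * M * s))) (Ici 0) := by
    refine antitoneOn_of_deriv_nonpos (convex_Ici 0) (hs.continuousOn_h.mul (by fun_prop)) ?_ ?_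
      <;> rw [interior_Ici]
    · exact fun s h1 => (hd' s h1).differentiableAt.differentiableWithinAt
    · intro s h1
      rw [(hd' s h1).deriv]
      have hs0 : 0 ≤ s := le_of_lt h1
      have h2 := hJ.flux_le (hh₀.le.trans (hs.le_h hd hμ hJ hf hu₀ hs0))
        (hs.continuousOn_slice hs0) hM.pos.le fun x hx => hs.le_of_isUpperBound hd hJ hM hs0 hx
      have h3 := mul_le_mul_of_nonneg_left h2 hμ.le
      have h4 := mul_le_mul_of_nonneg_right h3 (Real.exp_pos (-(μ * M * s))).le
      simp only [id, Pi.neg_apply]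
      linarith
  have h1 := hanti (mem_Ici.2 le_rfl) (mem_Ici.2 ht) ht
  simp only [mul_zero, neg_zero, Real.exp_zero, mul_one, hs.init_h] at h1
  rwa [Real.exp_neg, ← div_eq_mul_inv, div_le_iff₀ (Real.exp_pos _)] at h1

theorem abs_deriv_le (hs : IsFreeBoundarySolution d μ h₀ J f u₀ u h) (hd : 0 < d)
    (hJ : IsDispersalKernel J) (hf : IsMonostable f) (hu₀ : IsInitialDatum h₀ u₀)
    {M L K : ℝ} (hM : IsUpperBound h₀ f u₀ M) (hMK : M ≤ K)
    (hL : ∀ a b, |a| ≤ K → |b| ≤ K → |f a - f b| ≤ L * |a - b|) (hL0 : 0 ≤ L)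
    {t x : ℝ} (ht : 0 < t) (hx : x ∈ Icc 0 (h t)) :
    |d * (∫ y in Icc 0 (h t), J (x - y) * u t y) - d * halfLineMass J x * u t x + f (u t x)|
      ≤ (2 * d + L) * K := by
  have hK0 : 0 < K := hM.pos.trans_le hMK
  have hb : ∀ y ∈ Icc 0 (h t), |u t y| ≤ K := fun y hy => by
    rw [abs_of_nonneg (hs.nonneg hd hJ hf hu₀ ht.le hy)]
    exact (hs.le_of_isUpperBound hd hJ hM ht.le hy).trans hMK
  have h1 := abs_le.1 (hJ.abs_setIntegral_mul_le measurableSet_Icc hK0.le hb x)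
  have h2 := hL (u t x) 0 (hb x hx) (by simpa using hK0.le)
  rw [hf.zero, sub_zero, sub_zero] at h2
  have h3 := abs_le.1 (h2.trans (mul_le_mul_of_nonneg_left (hb x hx) hL0))
  have h4 : |halfLineMass J x * u t x| ≤ 1 * K := by
    rw [abs_mul, abs_of_nonneg (hJ.halfLineMass_nonneg x)]
    exact mul_le_mul (hJ.halfLineMass_le_one x) (hb x hx) (abs_nonneg _) zero_le_one
  have h5 := abs_le.1 h4
  rw [abs_le]
  constructor <;> nlinarith

theorem abs_sub_le_of_lt (hs : IsFreeBoundarySolution d μ h₀ J f u₀ u h) (hd : 0 < d)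
    (hJ : IsDispersalKernel J) (hf : IsMonostable f) (hu₀ : IsInitialDatum h₀ u₀)
    {M L K : ℝ} (hM : IsUpperBound h₀ f u₀ M) (hMK : M ≤ K)
    (hL : ∀ a b, |a| ≤ K → |b| ≤ K → |f a - f b| ≤ L * |a - b|) (hL0 : 0 ≤ L)
    {a b x : ℝ} (ha : 0 ≤ a) (hab : a ≤ b) (hx : 0 ≤ x) (hxa : x ≤ h a)
    (hxh : ∀ s ∈ Ioc a b, x < h s) :
    |u b x - u a x| ≤ (2 * d + L) * K * (b - a) := by
  rcases hab.eq_or_lt with rfl | hlt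
  · simp
  have hle : ∀ s ∈ Icc a b, x ≤ h s := fun s h1 => by
    rcases h1.1.eq_or_lt with h2 | h2
    · exact h2 ▸ hxa
    · exact (hxh s ⟨h2, h1.2⟩).le
  obtain ⟨c, hc, hceq⟩ := exists_hasDerivAt_eq_slope (fun s => u s x) _ hlt
    (hs.continuousOn_time ha hx hle)
    (fun s h1 => hs.eq_u s x (ha.trans_lt h1.1) hx (hxh s ⟨h1.1, h1.2.le⟩))
  have h1 := hs.abs_deriv_le hd hJ hf hu₀ hM hMK hL hL0 (ha.trans_lt hc.1)
    ⟨hx, hle c (Ioo_subset_Icc_self hc)⟩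
  rw [hceq, abs_div, abs_of_pos (sub_pos.2 hlt), div_le_iff₀ (sub_pos.2 hlt)] at h1
  exact h1

theorem abs_sub_datum_le (hs : IsFreeBoundarySolution d μ h₀ J f u₀ u h) (hd : 0 < d) (hμ : 0 < μ)
    (hh₀ : 0 < h₀) (hJ : IsDispersalKernel J) (hf : IsMonostable f) (hu₀ : IsInitialDatum h₀ u₀)
    {M L K : ℝ} (hM : IsUpperBound h₀ f u₀ M) (hMK : M ≤ K)
    (hL : ∀ a b, |a| ≤ K → |b| ≤ K → |f a - f b| ≤ L * |a - b|) (hL0 : 0 ≤ L)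
    {t x : ℝ} (ht : 0 ≤ t) (hx : x ∈ Icc 0 h₀) :
    |u t x - u₀ x| ≤ (2 * d + L) * K * t := by
  have h1 := hs.abs_sub_le_of_lt hd hJ hf hu₀ hM hMK hL hL0 le_rfl ht hx.1 (hs.init_h ▸ hx.2)
    fun s h2 => hx.2.trans_lt (hs.lt_h hd hμ hh₀ hJ hf hu₀ h2.1)
  rwa [hs.init_u x hx, sub_zero] at h1

/-- Let `a` be the last time up to `t` at which the front has not passed `x`. Then `h a = x` and `u
a x = 0`, and the bound on `u_t` applies from `a` to `t`. -/
theorem abs_le_mul_time (hs : IsFreeBoundarySolution d μ h₀ J f u₀ u h) (hd : 0 < d)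
    (hh₀ : 0 < h₀) (hJ : IsDispersalKernel J) (hf : IsMonostable f) (hu₀ : IsInitialDatum h₀ u₀)
    {M L K : ℝ} (hM : IsUpperBound h₀ f u₀ M) (hMK : M ≤ K)
    (hL : ∀ a b, |a| ≤ K → |b| ≤ K → |f a - f b| ≤ L * |a - b|) (hL0 : 0 ≤ L)
    {t x : ℝ} (ht : 0 ≤ t) (hx : x ∈ Icc h₀ (h t)) :
    |u t x| ≤ (2 * d + L) * K * t := by
  have hx0 : 0 ≤ x := hh₀.le.trans hx.1
  have hcont : ContinuousOn h (Icc 0 t) := hs.continuousOn_h.mono Icc_subset_Ici_self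
  have hZ : IsCompact (Icc 0 t ∩ h ⁻¹' Iic x) :=
    isCompact_Icc.of_isClosed_subset
      (hcont.preimage_isClosed_of_isClosed isClosed_Icc isClosed_Iic) inter_subset_left
  obtain ⟨a, ⟨ha, hax⟩, hmax⟩ := hZ.exists_isMaxOn
    ⟨0, ⟨le_rfl, ht⟩, show h 0 ≤ x from hs.init_h.symm ▸ hx.1⟩ continuousOn_id
  have hlt : ∀ s ∈ Ioc a t, x < h s := fun s h1 => by
    by_contra! h2
    exact absurd (hmax ⟨⟨ha.1.trans h1.1.le, h1.2⟩, h2⟩) (not_le.2 h1.1)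
  have hxa : h a = x := by
    obtain ⟨s, hs1, hs2⟩ := intermediate_value_Icc ha.2
      (hcont.mono (Icc_subset_Icc_left ha.1)) ⟨hax, hx.2⟩
    rcases hs1.1.eq_or_lt with h1 | h1
    · rwa [h1]
    · exact absurd hs2 (hlt s ⟨h1, hs1.2⟩).ne'
  have hua : u a x = 0 := by
    rcases ha.1.eq_or_lt with h1 | h1
    · have : x = h₀ := by rw [← hxa, ← h1, hs.init_h]
      rw [← h1, this, hs.init_u h₀ ⟨hh₀.le, le_rfl⟩, hu₀.end_eq_zero]
    · rw [← hxa, hs.boundary a h1]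
  have h1 := hs.abs_sub_le_of_lt hd hJ hf hu₀ hM hMK hL hL0 ha.1 ha.2 hx0 hxa.ge hlt
  rw [hua, sub_zero] at h1
  refine h1.trans (mul_le_mul_of_nonneg_left (by linarith [ha.1]) ?_)
  exact mul_nonneg (by linarith) (hM.pos.le.trans hMK)

end IsFreeBoundarySolution

/-- Near points cost the sharp bound `B` times the total mass; far points cost the crude bound `K`
times the tail mass. -/
theorem IsDispersalKernel.abs_setIntegral_mul_le_add {J : ℝ → ℝ} (hJ : IsDispersalKernel J)
    {s : Set ℝ} (hs : MeasurableSet s) {g : ℝ → ℝ} {B K ρ x : ℝ} (hB0 : 0 ≤ B)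
    (hK : ∀ y ∈ s, |g y| ≤ K) (hB : ∀ y ∈ s, |x - y| < ρ → |g y| ≤ B) (hK0 : 0 ≤ K) :
    |∫ y in s, J (x - y) * g y| ≤ B + (∫ z, kernelTail J ρ z) * K := by
  have htail : Integrable fun y => kernelTail J ρ (x - y) :=
    (hJ.integrable_kernelTail ρ).comp_sub_left x
  have htail0 : ∀ y, 0 ≤ kernelTail J ρ y := fun y => indicator_nonneg (fun z _ => hJ.nonneg z) y
  have hint : Integrable fun y => J (x - y) * B + kernelTail J ρ (x - y) * K :=
    ((hJ.integrable_sub x).mul_const B).add (htail.mul_const K)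
  have h1 : ‖∫ y in s, J (x - y) * g y‖
      ≤ ∫ y in s, (J (x - y) * B + kernelTail J ρ (x - y) * K) := by
    refine norm_integral_le_of_norm_le hint.integrableOn ?_
    refine (ae_restrict_iff' hs).2 (Eventually.of_forall fun y hy => ?_)
    have h2 := hJ.nonneg (x - y)
    rw [Real.norm_eq_abs, abs_mul, abs_of_nonneg h2]
    by_cases hy' : |x - y| < ρ
    · have := mul_le_mul_of_nonneg_left (hB y hy hy') h2
      linarith [mul_nonneg (htail0 (x - y)) hK0]
    · have h3 : kernelTail J ρ (x - y) = J (x - y) := 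
      indicator_of_mem (show x - y ∈ {z | ρ ≤ |z|} from not_lt.1 hy') J
      rw [h3]
      linarith [mul_le_mul_of_nonneg_left (hK y hy) h2, mul_nonneg h2 hB0]
  have h4 : ∫ y in s, (J (x - y) * B + kernelTail J ρ (x - y) * K)
      ≤ ∫ y, (J (x - y) * B + kernelTail J ρ (x - y) * K) :=
    setIntegral_le_integral hint (Eventually.of_forall fun y =>
      add_nonneg (mul_nonneg (hJ.nonneg _) hB0) (mul_nonneg (htail0 _) hK0))
  rw [integral_add ((hJ.integrable_sub x).mul_const B) (htail.mul_const K), integral_mul_const,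
    integral_mul_const, hJ.integral_sub,
    integral_sub_left_eq_self (fun z => kernelTail J ρ z) volume x, one_mul] at h4
  exact h1.trans h4

/-! ### The limit μ → 0 -/

theorem IsFixedDomainSolution.exists_estimate {d h₀ : ℝ} {J f u₀ : ℝ → ℝ} {v : ℝ → ℝ → ℝ}
    (hv : IsFixedDomainSolution d h₀ J f u₀ v) (hd : 0 < d) (hh₀ : 0 < h₀)
    (hJ : IsDispersalKernel J) (hf : IsMonostable f) (hu₀ : IsInitialDatum h₀ u₀) {M : ℝ}
    (hM : IsUpperBound h₀ f u₀ M) {T : ℝ} (hT : 0 < T) :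
    ∃ A : ℝ, ∀ μ > 0, ∀ u h, IsFreeBoundarySolution d μ h₀ J f u₀ u h →
      ∀ t ∈ Ioo 0 T, ∀ x ∈ Icc 0 h₀,
        |v t x - u t x| ≤ A * (Real.exp (μ * M * T) - 1) ∧
        |deriv (fun s => v s x) t - deriv (fun s => u s x) t|
          ≤ A * (Real.exp (μ * M * T) - 1) := by
  obtain ⟨Kv, hKv⟩ := (isCompact_Icc.prod isCompact_Icc).exists_bound_of_continuousOn
    (hv.continuousOn.mono (prod_mono_left (show Icc 0 T ⊆ Ici 0 from Icc_subset_Ici_self)))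
  set K := max M Kv
  have hMK : M ≤ K := le_max_left _ _
  have hK0 : 0 < K := hM.pos.trans_le hMK
  obtain ⟨L, hL0, hL⟩ := hf.exists_lipschitz K
  obtain ⟨CJ, hCJ⟩ := hJ.bounded
  have hCJ0 : 0 ≤ CJ := (hJ.nonneg 0).trans (hCJ 0)
  set L' := 2 * d + L with hL'
  have hL'0 : 0 ≤ L' := by positivity
  set A₀ := d * (CJ * K * h₀) with hA₀
  have hA₀0 : 0 ≤ A₀ := by positivity
  -- The first summand bounds `v - u`; the bracket, from feeding that bound back into the equations,
  -- bounds the difference of the derivatives. Neither depends on μ.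
  refine ⟨A₀ * T * Real.exp (L' * T) + (L' * (A₀ * T * Real.exp (L' * T)) + A₀), ?_⟩
  intro μ hμ u h hs
  set g := Real.exp (μ * M * T) - 1 with hg
  have hg0 : 0 ≤ g := sub_nonneg.2 (Real.one_le_exp (mul_nonneg (mul_nonneg hμ.le hM.pos.le) hT.le))
  have hhg : ∀ t ∈ Icc 0 T, h t - h₀ ≤ h₀ * g := fun t ht => by
    have h1 := hs.h_le_exp hd hμ hh₀ hJ hf hu₀ hM ht.1
    have h2 : Real.exp (μ * M * t) ≤ Real.exp (μ * M * T) := by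
      have := hM.pos
      have := ht.2
      gcongr
    have h3 := mul_le_mul_of_nonneg_left h2 hh₀.le
    rw [hg]; linarith
  have hh₀t : ∀ t ∈ Icc 0 T, h₀ ≤ h t := fun t ht => hs.le_h hd hμ hJ hf hu₀ ht.1
  have hub : ∀ t ∈ Icc 0 T, ∀ y ∈ Icc 0 (h t), |u t y| ≤ K := fun t ht y hy => by
    rw [abs_of_nonneg (hs.nonneg hd hJ hf hu₀ ht.1 hy)]
    exact (hs.le_of_isUpperBound hd hJ hM ht.1 hy).trans hMK
  have hvb : ∀ t ∈ Icc 0 T, ∀ y ∈ Icc 0 h₀, |v t y| ≤ K := fun t ht y hy =>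
    (hKv (t, y) ⟨ht, hy⟩).trans (le_max_right _ _)
  set w' : ℝ → ℝ → ℝ := fun t x =>
    (d * (∫ y in Icc 0 h₀, J (x - y) * v t y) - d * halfLineMass J x * v t x + f (v t x))
    - (d * (∫ y in Icc 0 (h t), J (x - y) * u t y) - d * halfLineMass J x * u t x + f (u t x))
    with hw'
  have hdu : ∀ t ∈ Ioo 0 T, ∀ x ∈ Icc 0 h₀, HasDerivAt (fun s => u s x) _ t :=
    fun t ht x hx => hs.eq_u t x ht.1 hx.1 (hx.2.trans_lt (hs.lt_h hd hμ hh₀ hJ hf hu₀ ht.1))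
  have hder : ∀ t ∈ Ioo 0 T, ∀ x ∈ Icc 0 h₀, HasDerivAt (fun s => v s x - u s x) (w' t x) t :=
    fun t ht x hx => (hv.eq_v t x ht.1 hx).sub (hdu t ht x hx)
  have hrate : ∀ t ∈ Ioo 0 T, ∀ B, (∀ y ∈ Icc 0 h₀, |v t y - u t y| ≤ B) →
      ∀ x ∈ Icc 0 h₀, |w' t x| ≤ L' * B + A₀ * g := by
    intro t ht B hB x hx
    have htI := Ioo_subset_Icc_self ht
    have hB0 : 0 ≤ B := (abs_nonneg _).trans (hB x hx)
    have hcu := hs.continuousOn_slice htI.1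
    have hcu₀ : ContinuousOn (u t) (Icc 0 h₀) := hcu.mono (Icc_subset_Icc_right (hh₀t t htI))
    have hcv : ContinuousOn (v t) (Icc 0 h₀) :=
      hv.continuousOn.comp (continuousOn_const.prodMk continuousOn_id) fun y hy => ⟨htI.1, hy⟩
    have hsplit : ∫ y in Icc 0 (h t), J (x - y) * u t y
        = (∫ y in Icc 0 h₀, J (x - y) * u t y) + ∫ y in Ioc h₀ (h t), J (x - y) * u t y := by
      rw [← Icc_union_Ioc_eq_Icc hh₀.le (hh₀t t htI)]
      refine setIntegral_union ?_ measurableSet_Ioc (hJ.integrableOn_mul_Icc hcu₀ x)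
        ((hJ.integrableOn_mul_Icc hcu x).mono_set fun y hy => ⟨hh₀.le.trans hy.1.le, hy.2⟩)
      exact disjoint_left.2 fun y hy hy' => absurd hy.2 (not_le.2 hy'.1)
    have hdiff : ∫ y in Icc 0 h₀, J (x - y) * (v t y - u t y)
        = (∫ y in Icc 0 h₀, J (x - y) * v t y) - ∫ y in Icc 0 h₀, J (x - y) * u t y := by
      simp only [mul_sub]
      exact integral_sub (hJ.integrableOn_mul_Icc hcv x) (hJ.integrableOn_mul_Icc hcu₀ x)
    have h1 := abs_le.1 (hJ.abs_setIntegral_mul_le measurableSet_Icc hB0 hB x)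
    have h2 : |∫ y in Ioc h₀ (h t), J (x - y) * u t y| ≤ CJ * K * (h t - h₀) := by
      have := norm_setIntegral_le_of_norm_le_const (μ := volume) (s := Ioc h₀ (h t))
        (f := fun y => J (x - y) * u t y) (C := CJ * K) (by simp) fun y hy => by
          rw [Real.norm_eq_abs, abs_mul, abs_of_nonneg (hJ.nonneg _)]
          exact mul_le_mul (hCJ _) (hub t htI y ⟨hh₀.le.trans hy.1.le, hy.2⟩) (abs_nonneg _) hCJ0
      simpa [Measure.real, hh₀t t htI] using this
    have h3 : CJ * K * (h t - h₀) ≤ CJ * K * (h₀ * g) :=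
      mul_le_mul_of_nonneg_left (hhg t htI) (mul_nonneg hCJ0 hK0.le)
    have h4 := abs_le.1 (h2.trans h3)
    have h5 : |halfLineMass J x * (v t x - u t x)| ≤ 1 * B := by
      rw [abs_mul, abs_of_nonneg (hJ.halfLineMass_nonneg x)]
      exact mul_le_mul (hJ.halfLineMass_le_one x) (hB x hx) (abs_nonneg _) zero_le_one
    have h6 := abs_le.1 h5
    have h7 := abs_le.1 ((hL _ _ (hvb t htI x hx)
      (hub t htI x ⟨hx.1, hx.2.trans (hh₀t t htI)⟩)).trans
      (mul_le_mul_of_nonneg_left (hB x hx) hL0))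
    have h8 : w' t x = d * ((∫ y in Icc 0 h₀, J (x - y) * (v t y - u t y))
        - (∫ y in Ioc h₀ (h t), J (x - y) * u t y) - halfLineMass J x * (v t x - u t x))
        + (f (v t x) - f (u t x)) := by
      rw [hdiff, hw']; simp only [hsplit]; ring
    have h9 : |(∫ y in Icc 0 h₀, J (x - y) * (v t y - u t y))
        - (∫ y in Ioc h₀ (h t), J (x - y) * u t y) - halfLineMass J x * (v t x - u t x)|
        ≤ 2 * B + CJ * K * (h₀ * g) := by
      rw [abs_le]; constructor <;> linarith
    have h10 := abs_le.1 h9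
    have h11 := mul_le_mul_of_nonneg_left h10.1 hd.le
    have h12 := mul_le_mul_of_nonneg_left h10.2 hd.le
    rw [h8, hL', hA₀, abs_le]
    constructor <;> linarith
  have hEg : 0 ≤ A₀ * g := mul_nonneg hA₀0 hg0
  have hgron := abs_le_of_abs_deriv_le_nested (S := fun _ => Icc 0 h₀)
    (w := fun t x => v t x - u t x) (w' := w') (a := 0) (b := T) (K := 2 * K) (L := L')
    (E := A₀ * g) (ε := 0) hEg (fun _ => Subset.rfl)
    (fun x hx => (hv.continuousOn.comp (continuousOn_id.prodMk continuousOn_const)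
      fun s h1 => ⟨h1.1, hx⟩).sub
      (hs.continuousOn_time le_rfl hx.1 fun s h1 => hx.2.trans (hh₀t s h1)))
    hder (fun x hx => by rw [hv.init x hx, hs.init_u x hx]; simp)
    (fun t ht x hx => by
      have h1 := abs_le.1 (hvb t ht x hx)
      have h2 := abs_le.1 (hub t ht x ⟨hx.1, hx.2.trans (hh₀t t ht)⟩)
      rw [abs_le]; constructor <;> linarith)
    (fun _ => hrate)
  have hw : ∀ t ∈ Ioo 0 T, ∀ x ∈ Icc 0 h₀,
      |v t x - u t x| ≤ A₀ * T * Real.exp (L' * T) * g := by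
    intro t ht x hx
    -- All sets `S n` equal `[0, h₀]`, so letting `n → ∞` removes the crude term and leaves the
    -- usual Grönwall bound.
    have hlim : Tendsto (fun n : ℕ => 2 * K * ((L' * (t - 0)) ^ n / n.factorial)
        + (0 + A₀ * g * (T - 0)) * Real.exp (L' * (t - 0))) atTop
        (𝓝 (2 * K * 0 + (0 + A₀ * g * (T - 0)) * Real.exp (L' * (t - 0)))) :=
      ((FloorSemiring.tendsto_pow_div_factorial_atTop _).const_mul _).add_const _
    have h1 := ge_of_tendsto' hlim fun n => hgron n t (Ioo_subset_Icc_self ht) x hx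
    have h2 : Real.exp (L' * (t - 0)) ≤ Real.exp (L' * T) :=
      Real.exp_le_exp.2 (mul_le_mul_of_nonneg_left (by linarith [ht.2]) hL'0)
    have h3 := mul_le_mul_of_nonneg_left h2 (mul_nonneg hEg hT.le)
    refine h1.trans ?_
    simp only [sub_zero, mul_zero, zero_add] at h3 ⊢
    linarith
  intro t ht x hx
  have h1 := hw t ht x hx
  have h2 := hrate t ht _ (hw t ht) x hx
  rw [(hv.eq_v t x ht.1 hx).deriv, (hdu t ht x hx).deriv]
  have h3 : 0 ≤ A₀ * T * Real.exp (L' * T) * g := by positivity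
  have h4 : 0 ≤ L' * (A₀ * T * Real.exp (L' * T) * g) := by positivity
  constructor
  · linarith
  · change |w' t x| ≤ _
    linarith

/-! ### The limit μ → ∞ -/

/-- The step `s` is fixed before `n`, so finitely many steps reach any point. The delay `δ` is
quantified inside the induction, which lets each step spend half of it on the previous one. The
start `h₀ / 2` keeps away from the zero of `u₀`. -/
theorem exists_lower_bound_of_large_rate {d h₀ : ℝ} {J f u₀ : ℝ → ℝ} (hd : 0 < d) (hh₀ : 0 < h₀)
    (hJ : IsDispersalKernel J) (hf : IsMonostable f) (hu₀ : IsInitialDatum h₀ u₀) (T : ℝ) :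
    ∃ s > 0, ∀ n : ℕ, ∀ δ > 0, ∃ c > 0, ∃ μ₀ > 0, ∀ μ ≥ μ₀, ∀ u h,
      IsFreeBoundarySolution d μ h₀ J f u₀ u h → ∀ t ∈ Icc δ T,
        h₀ / 2 + n * s ≤ h t ∧ ∀ x ∈ Icc 0 (h₀ / 2 + n * s), c ≤ u t x := by
  obtain ⟨M, hM⟩ := hu₀.exists_isUpperBound hf
  obtain ⟨L, hL0, hL⟩ := hf.exists_lipschitz M
  obtain ⟨c₀, hc₀, r, hr, hJr⟩ := hJ.exists_pos_le_near_zero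
  set s := min (r / 4) (h₀ / 2)
  have hsr : s ≤ r / 4 := min_le_left _ _
  have hsh : s ≤ h₀ / 2 := min_le_right _ _
  have hs0 : 0 < s := lt_min (by linarith) (by linarith)
  refine ⟨s, hs0, fun n => ?_⟩
  induction n with
  | zero =>
    intro δ hδ
    obtain ⟨x₁, hx₁, hmin⟩ := isCompact_Icc.exists_isMinOn
      (nonempty_Icc.2 (half_pos hh₀).le)
      (hu₀.continuousOn.mono (Icc_subset_Icc_right (half_le_self hh₀.le)))
    have hx₁0 : 0 < u₀ x₁ := hu₀.pos x₁ ⟨hx₁.1, by linarith [hx₁.2]⟩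
    refine ⟨Real.exp (-((d + L) * T)) * u₀ x₁, by positivity, 1, one_pos, ?_⟩
    intro μ hμ u h hs t ht
    have hμ0 : 0 < μ := one_pos.trans_le hμ
    have ht0 : 0 ≤ t := hδ.le.trans ht.1
    simp only [Nat.cast_zero, zero_mul, add_zero]
    refine ⟨by linarith [hs.le_h hd hμ0 hJ hf hu₀ ht0], fun x hx => ?_⟩
    have h1 := hs.exp_mul_datum_le hd hμ0 hJ hf hu₀ hM hL0 hL ht0
      (x := x) ⟨hx.1, by linarith [hx.2]⟩
    refine le_trans (mul_le_mul (Real.exp_le_exp.2 ?_) (hmin hx) hx₁0.le (Real.exp_pos _).le) h1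
    have := mul_le_mul_of_nonneg_left ht.2 (add_nonneg hd.le hL0)
    linarith
  | succ n ih =>
    intro δ hδ
    obtain ⟨c, hc, μ₀, hμ₀, ih⟩ := ih (δ / 2) (half_pos hδ)
    set R := h₀ / 2 + n * s with hR
    have hR' : h₀ / 2 + ((n + 1 : ℕ) : ℝ) * s = R + s := by push_cast; ring
    have hRs : s ≤ R := by
      have : 0 ≤ (n : ℝ) * s := by positivity
      linarith
    rw [hR']
    set F := c₀ * c * s ^ 2 * (δ / 4) with hF
    have hF0 : 0 < F := by positivity
    -- Mass on `[R - s, R]` feeds `(R, R + s]` at rate at least `d c₀ c s` for a time `δ / 4`,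
    -- damped by the exponential.
    set c₁ := Real.exp (-((d + L) * (δ / 4))) * (d * (c₀ * c * s) * (δ / 4)) with hc₁
    have hc₁0 : 0 < c₁ := by positivity
    refine ⟨min c c₁, lt_min hc hc₁0, max μ₀ (2 * s / F + 1), lt_max_of_lt_left hμ₀, ?_⟩
    intro μ hμ u h hs t ht
    have hμ1 : μ₀ ≤ μ := (le_max_left _ _).trans hμ
    have hμ2 : 2 * s / F + 1 ≤ μ := (le_max_right _ _).trans hμ
    have hμ0 : 0 < μ := hμ₀.trans_le hμ1
    have ih' := ih μ hμ1 u h hs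
    have hmono := hs.monotoneOn hd hμ0 hJ hf hu₀
    -- While `h < R + 2s`, jumps from `[R - s, R]` to `[h, h + s]` have length at most `4s ≤ r`, so
    -- over `[δ/2, 3δ/4]` the front gains at least `μ F > 2s`. Going to `R + 2s` keeps all `x ≤ R +
    -- s` strictly inside.
    have hjump : R + 2 * s ≤ h (3 * δ / 4) := by
      by_contra! hlt
      obtain ⟨τ, hτ, hslope⟩ := exists_hasDerivAt_eq_slope h _
        (by linarith : δ / 2 < 3 * δ / 4)
        (hs.continuousOn_h.mono fun x hx => (half_pos hδ).le.trans hx.1)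
        fun x hx => hs.eq_h x ((half_pos hδ).trans hx.1)
      have hτ0 : 0 ≤ τ := (half_pos hδ).le.trans hτ.1.le
      have hτI : τ ∈ Icc (δ / 2) T := ⟨hτ.1.le, by linarith [hτ.2, ht.1, ht.2]⟩
      have h1 : h τ < R + 2 * s :=
        (hmono hτ0 (mem_Ici.2 (by linarith)) hτ.2.le).trans_lt hlt
      have h2 := hJ.le_flux (g := u τ) (b := h τ) (p := R - s) (m := c) hJr hs0
        (hs.continuousOn_slice hτ0) (fun x hx => hs.nonneg hd hJ hf hu₀ hτ0 hx) hc.le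
        (by linarith) (by linarith [(ih' τ hτI).1]) (by linarith)
        (fun x hx => (ih' τ hτI).2 x ⟨by linarith [hx.1], by linarith [hx.2]⟩)
      have h3 := mul_le_mul_of_nonneg_left h2 hμ0.le
      rw [hslope, le_div_iff₀ (by linarith)] at h3
      have h4 := (ih' (δ / 2) ⟨le_rfl, by linarith [ht.1, ht.2]⟩).1
      have h5 : (2 * s / F + 1) * F ≤ μ * F := mul_le_mul_of_nonneg_right hμ2 hF0.le
      rw [add_mul, div_mul_cancel₀ _ hF0.ne', one_mul] at h5
      have h6 : μ * (c₀ * c * s ^ 2) * (3 * δ / 4 - δ / 2) = μ * F := by rw [hF]; ring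
      linarith
    have hge : ∀ τ, 3 * δ / 4 ≤ τ → R + 2 * s ≤ h τ := fun τ hτ =>
      hjump.trans (hmono (mem_Ici.2 (by linarith)) (mem_Ici.2 (by linarith)) hτ)
    have htδ := ht.1
    refine ⟨by linarith [hge t (by linarith)], fun x hx => ?_⟩
    by_cases hxR : x ≤ R
    · exact (min_le_left _ _).trans ((ih' t ⟨by linarith, ht.2⟩).2 x ⟨hx.1, hxR⟩)
    push Not at hxR
    refine (min_le_right _ _).trans ?_
    have hxR2 := hx.2
    have ha0 : 0 ≤ t - δ / 4 := by linarith
    have hax : x ≤ h (t - δ / 4) := by linarith [hge (t - δ / 4) (by linarith)]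
    have h1 := hs.exp_mul_le hd hJ hf hu₀ hM hL0 hL (a := t - δ / 4) (b := t) (x := x)
      (κ := d * (c₀ * c * s)) ha0 (by linarith) hx.1 hax
      (fun τ hτ => by linarith [hge τ (by linarith [hτ.1])]) (by positivity) (fun τ hτ => by
        have hτ0 : 0 ≤ τ := ha0.trans hτ.1.le
        have hhτ := hge τ (by linarith [hτ.1])
        refine mul_le_mul_of_nonneg_left ?_ hd.le
        have h2 := mul_sub_le_setIntegral (p := R - s) (q := R) (m := c₀ * c) measurableSet_Icc
          (hJ.integrableOn_mul_Icc (hs.continuousOn_slice hτ0) x)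
          (fun y hy => mul_nonneg (hJ.nonneg _) (hs.nonneg hd hJ hf hu₀ hτ0 hy))
          (by linarith) (Icc_subset_Icc (by linarith) (by linarith)) (fun y hy => ?_)
        · calc c₀ * c * s = c₀ * c * (R - (R - s)) := by ring
            _ ≤ _ := h2
        · refine mul_le_mul (hJr _ ?_) ((ih' τ ⟨by linarith [hτ.1], by linarith [hτ.2, ht.2]⟩).2 y
            ⟨by linarith [hy.1], hy.2⟩) hc.le (hJ.nonneg _)
          rw [abs_le]
          constructor <;> linarith [hy.1, hy.2])
    have hua := hs.nonneg hd hJ hf hu₀ ha0 ⟨hx.1, hax⟩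
    refine le_trans ?_ h1
    rw [sub_sub_cancel]
    exact mul_le_mul_of_nonneg_left (by linarith) (Real.exp_pos _).le

theorem exists_forall_le_h_of_large_rate {d h₀ : ℝ} {J f u₀ : ℝ → ℝ} (hd : 0 < d) (hh₀ : 0 < h₀)
    (hJ : IsDispersalKernel J) (hf : IsMonostable f) (hu₀ : IsInitialDatum h₀ u₀) {δ : ℝ}
    (hδ : 0 < δ) (R : ℝ) :
    ∃ μ₀ > 0, ∀ μ ≥ μ₀, ∀ u h, IsFreeBoundarySolution d μ h₀ J f u₀ u h →
      ∀ t ≥ δ, R ≤ h t := by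
  obtain ⟨s, hs0, H⟩ := exists_lower_bound_of_large_rate hd hh₀ hJ hf hu₀ δ
  obtain ⟨n, hn⟩ := exists_nat_ge (R / s)
  obtain ⟨c, -, μ₀, hμ₀, H⟩ := H n δ hδ
  refine ⟨μ₀, hμ₀, fun μ hμ u h hs t ht => ?_⟩
  have h1 := (H μ hμ u h hs δ ⟨le_rfl, le_rfl⟩).1
  have h2 := hs.monotoneOn hd (hμ₀.trans_le hμ) hJ hf hu₀ (mem_Ici.2 hδ.le)
    (mem_Ici.2 (hδ.le.trans ht)) ht
  rw [div_le_iff₀ hs0] at hn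
  linarith

namespace IsHalfLineSolution

variable {d h₀ : ℝ} {J f u₀ : ℝ → ℝ} {V : ℝ → ℝ → ℝ}

theorem continuousOn_slice (hV : IsHalfLineSolution d h₀ J f u₀ V) {t : ℝ} (ht : 0 ≤ t) :
    ContinuousOn (V t) (Ici 0) :=
  hV.continuousOn.comp (continuousOn_const.prodMk continuousOn_id) fun _ hy => ⟨ht, hy⟩

theorem continuousOn_time (hV : IsHalfLineSolution d h₀ J f u₀ V) {a b x : ℝ} (ha : 0 ≤ a)
    (hx : 0 ≤ x) : ContinuousOn (fun s => V s x) (Icc a b) :=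
  hV.continuousOn.comp (continuousOn_id.prodMk continuousOn_const) fun _ hs => ⟨ha.trans hs.1, hx⟩

theorem abs_sub_initial_le (hV : IsHalfLineSolution d h₀ J f u₀ V) (hd : 0 < d)
    (hJ : IsDispersalKernel J) (hf : IsMonostable f) {K L T : ℝ}
    (hK : ∀ t ∈ Icc 0 T, ∀ x, 0 ≤ x → |V t x| ≤ K)
    (hL : ∀ a b, |a| ≤ K → |b| ≤ K → |f a - f b| ≤ L * |a - b|) (hL0 : 0 ≤ L)
    {t x : ℝ} (ht : t ∈ Icc 0 T) (hx : 0 ≤ x) :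
    |V t x - V 0 x| ≤ (2 * d + L) * K * t := by
  rcases ht.1.eq_or_lt with rfl | hlt
  · simp
  obtain ⟨c, hc, hceq⟩ := exists_hasDerivAt_eq_slope (fun s => V s x) _ hlt
    (hV.continuousOn_time le_rfl hx) (fun s h1 => hV.eq_V s x h1.1 hx)
  have hcT : c ∈ Icc 0 T := ⟨hc.1.le, hc.2.le.trans ht.2⟩
  have hVc := hK c hcT x hx
  have hK0 : 0 ≤ K := (abs_nonneg _).trans hVc
  have h1 := abs_le.1 (hJ.abs_setIntegral_mul_le (s := Ioi 0) (g := fun y => V c y - V c x)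
    (B := 2 * K) measurableSet_Ioi (by linarith) (fun y hy => by
      have h2 := abs_le.1 (hK c hcT y (le_of_lt hy))
      have h3 := abs_le.1 hVc
      rw [abs_le]; constructor <;> linarith) x)
  have h2 := hL (V c x) 0 hVc (by simpa using hK0)
  rw [hf.zero, sub_zero, sub_zero] at h2
  have h3 := abs_le.1 (h2.trans (mul_le_mul_of_nonneg_left hVc hL0))
  have h4 : |d * (∫ y in Ioi (0 : ℝ), J (x - y) * (V c y - V c x)) + f (V c x)|
      ≤ (2 * d + L) * K := by
    rw [abs_le]; constructor <;> nlinarith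
  rw [hceq, abs_div, abs_of_pos (sub_pos.2 hlt), div_le_iff₀ (sub_pos.2 hlt), sub_zero] at h4
  exact h4

theorem exists_estimate (hV : IsHalfLineSolution d h₀ J f u₀ V) (hd : 0 < d) (hh₀ : 0 < h₀)
    (hJ : IsDispersalKernel J) (hf : IsMonostable f) (hu₀ : IsInitialDatum h₀ u₀) {τ T b η : ℝ}
    (hτ : 0 < τ) (hτT : τ ≤ T) (hη : 0 < η) :
    ∃ μ₀ > 0, ∀ μ ≥ μ₀, ∀ u h, IsFreeBoundarySolution d μ h₀ J f u₀ u h →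
      ∀ t ∈ Icc τ T, ∀ x ∈ Icc 0 b, |V t x - u t x| < η := by
  obtain ⟨M, hM⟩ := hu₀.exists_isUpperBound hf
  obtain ⟨KV, hKV⟩ := hV.bounded T
  set K := max M KV
  have hMK : M ≤ K := le_max_left _ _
  have hK0 : 0 < K := hM.pos.trans_le hMK
  have hT : 0 < T := hτ.trans_le hτT
  obtain ⟨L, hL0, hL⟩ := hf.exists_lipschitz K
  have hVb : ∀ t ∈ Icc 0 T, ∀ y, 0 ≤ y → |V t y| ≤ K := fun t ht y hy =>
    (hKV t ht y hy).trans (le_max_right _ _)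
  set L' := 2 * d + L with hL'
  have hL'0 : 0 < L' := by positivity
  set Q := Real.exp (L' * T) with hQ
  have hQ0 : 0 < Q := Real.exp_pos _
  -- The error `η` is split in three: `n` handles the crude term, `ρ` the kernel tail, and `δ` the
  -- discrepancy at the starting time. Only then is μ taken large, so that the front is beyond `b +
  -- nρ` from time `δ` on.
  obtain ⟨n, hn⟩ : ∃ n : ℕ, 2 * K * ((L' * T) ^ n / n.factorial) < η / 3 := by
    have h1 : Tendsto (fun n : ℕ => 2 * K * ((L' * T) ^ n / n.factorial)) atTop (𝓝 (2 * K * 0)) :=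
      (FloorSemiring.tendsto_pow_div_factorial_atTop _).const_mul _
    rw [mul_zero] at h1
    exact (h1.eventually_lt_const (by positivity)).exists
  obtain ⟨ρ, hρ, htail⟩ := hJ.exists_integral_kernelTail_lt
    (show 0 < η / 3 / (d * (2 * K) * T * Q) by positivity)
  rw [lt_div_iff₀ (by positivity)] at htail
  set θ := ∫ z, kernelTail J ρ z
  have hθ0 : 0 ≤ θ := integral_nonneg fun y => indicator_nonneg (fun z _ => hJ.nonneg z) y
  set δ := min τ (η / 3 / (2 * (L' * K) * Q))
  have hδ0 : 0 < δ := lt_min hτ (by positivity)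
  have hδτ : δ ≤ τ := min_le_left _ _
  have hδη : δ * (2 * (L' * K) * Q) ≤ η / 3 :=
    (le_div_iff₀ (by positivity)).1 (min_le_right _ _)
  obtain ⟨μ₀, hμ₀, Hh⟩ := exists_forall_le_h_of_large_rate hd hh₀ hJ hf hu₀ hδ0
    (b + n * ρ + 1)
  refine ⟨μ₀, hμ₀, fun μ hμ u h hs => ?_⟩
  have hμ0 : 0 < μ := hμ₀.trans_le hμ
  have hh := Hh μ hμ u h hs
  have hub : ∀ t, 0 ≤ t → ∀ y ∈ Icc 0 (h t), |u t y| ≤ K := fun t ht y hy => by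
    rw [abs_of_nonneg (hs.nonneg hd hJ hf hu₀ ht hy)]
    exact (hs.le_of_isUpperBound hd hJ hM ht hy).trans hMK
  -- The subtraction is in the reals; `S 0` lies behind the front and `S n = [0, b]`.
  set S : ℕ → Set ℝ := fun m => Icc 0 (b + (n - m) * ρ) with hS
  have hSh : ∀ m, ∀ t ≥ δ, ∀ x ∈ S m, x < h t := fun m t ht x hx => by
    have h1 := hh t ht
    have h2 := hx.2
    have h3 : 0 ≤ (m : ℝ) * ρ := by positivity
    linarith
  set w' : ℝ → ℝ → ℝ := fun t x =>
    (d * (∫ y in Ioi (0 : ℝ), J (x - y) * (V t y - V t x)) + f (V t x))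
    - (d * (∫ y in Icc 0 (h t), J (x - y) * u t y) - d * halfLineMass J x * u t x + f (u t x))
    with hw'
  have hrate : ∀ m, ∀ t ∈ Ioo δ T, ∀ B, (∀ y ∈ S m, |V t y - u t y| ≤ B) →
      ∀ x ∈ S (m + 1), |w' t x| ≤ L' * B + d * (2 * K) * θ := by
    intro m t ht B hB x hx
    have ht0 : 0 < t := hδ0.trans ht.1
    have htI : t ∈ Icc 0 T := ⟨ht0.le, ht.2.le⟩
    have hxS : x ∈ S m := ⟨hx.1, by have := hx.2; push_cast at this; linarith⟩
    have hxh := hSh m t ht.1.le x hxS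
    have hB0 : 0 ≤ B := (abs_nonneg _).trans (hB x hxS)
    -- Extending `u` by zero past the front puts both dispersal integrals on the half-line; beyond
    -- `S m` only `|V - U| ≤ 2K` is used.
    set U : ℝ → ℝ := indicator (Ioc 0 (h t)) (u t) with hU
    have hJU : (fun y => J (x - y) * U y)
        = indicator (Ioc 0 (h t)) fun y => J (x - y) * u t y := by
      funext y
      by_cases hy : y ∈ Ioc 0 (h t) <;> simp [hU, hy]
    have hIU : Integrable fun y => J (x - y) * U y := by
      rw [hJU, integrable_indicator_iff measurableSet_Ioc]
      exact (hJ.integrableOn_mul_Icc (hs.continuousOn_slice ht0.le) x).mono_set Ioc_subset_Icc_self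
    have hIV : IntegrableOn (fun y => J (x - y) * V t y) (Ioi 0) := by
      refine (hJ.integrable_sub x).integrableOn.mul_bdd (c := K)
        (((hV.continuousOn_slice ht0.le).mono Ioi_subset_Ici_self).aestronglyMeasurable
          measurableSet_Ioi) ?_
      exact (ae_restrict_iff' measurableSet_Ioi).2
        (Eventually.of_forall fun y hy => hVb t htI y (le_of_lt hy))
    have h1 : ∫ y in Ioi (0 : ℝ), J (x - y) * (V t y - V t x)
        = (∫ y in Ioi (0 : ℝ), J (x - y) * V t y) - halfLineMass J x * V t x := by
      simp only [mul_sub]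
      rw [integral_sub hIV ((hJ.integrable_sub x).mul_const _).integrableOn, integral_mul_const]
      rfl
    have h2 : ∫ y in Icc 0 (h t), J (x - y) * u t y = ∫ y in Ioi (0 : ℝ), J (x - y) * U y := by
      rw [hJU, setIntegral_indicator measurableSet_Ioc, inter_eq_right.2 Ioc_subset_Ioi_self,
        integral_Icc_eq_integral_Ioc]
    have h3 : ∫ y in Ioi (0 : ℝ), J (x - y) * (V t y - U y)
        = (∫ y in Ioi (0 : ℝ), J (x - y) * V t y) - ∫ y in Ioi (0 : ℝ), J (x - y) * U y := by
      simp only [mul_sub]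
      exact integral_sub hIV hIU.integrableOn
    have hUb : ∀ y, |U y| ≤ K := fun y => by
      by_cases hy : y ∈ Ioc 0 (h t)
      · rw [hU, indicator_of_mem hy]; exact hub t ht0.le y (Ioc_subset_Icc_self hy)
      · rw [hU, indicator_of_notMem hy]; simpa using hK0.le
    have h4 := abs_le.1 (hJ.abs_setIntegral_mul_le_add (s := Ioi 0) (g := fun y => V t y - U y)
      (B := B) (K := 2 * K) (ρ := ρ) (x := x) measurableSet_Ioi hB0 (fun y hy => by
        have h5 := abs_le.1 (hVb t htI y (le_of_lt hy))
        have h6 := abs_le.1 (hUb y)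
        rw [abs_le]; constructor <;> linarith) (fun y hy hxy => by
        have hyS : y ∈ S m := ⟨le_of_lt hy, by
          have h5 := hx.2
          have h6 := (abs_lt.1 hxy).1
          push_cast at h5
          linarith⟩
        have hyU : U y = u t y := indicator_of_mem
          (show y ∈ Ioc 0 (h t) from ⟨hy, (hSh m t ht.1.le y hyS).le⟩) _
        simpa only [hyU] using hB y hyS) (by linarith))
    have h5 : |halfLineMass J x * (V t x - u t x)| ≤ 1 * B := by
      rw [abs_mul, abs_of_nonneg (hJ.halfLineMass_nonneg x)]
      exact mul_le_mul (hJ.halfLineMass_le_one x) (hB x hxS) (abs_nonneg _) zero_le_one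
    have h6 := abs_le.1 h5
    have h7 := abs_le.1 ((hL _ _ (hVb t htI x hx.1) (hub t ht0.le x ⟨hx.1, hxh.le⟩)).trans
      (mul_le_mul_of_nonneg_left (hB x hxS) hL0))
    have h8 : w' t x = d * ((∫ y in Ioi (0 : ℝ), J (x - y) * (V t y - U y))
        - halfLineMass J x * (V t x - u t x)) + (f (V t x) - f (u t x)) := by
      rw [h3, ← h2, hw']; simp only [h1]; ring
    have h9 : |(∫ y in Ioi (0 : ℝ), J (x - y) * (V t y - U y))
        - halfLineMass J x * (V t x - u t x)| ≤ 2 * B + θ * (2 * K) := by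
      rw [abs_le]; constructor <;> linarith
    have h10 := abs_le.1 h9
    have h11 := mul_le_mul_of_nonneg_left h10.1 hd.le
    have h12 := mul_le_mul_of_nonneg_left h10.2 hd.le
    rw [h8, hL', abs_le]
    constructor <;> linarith
  have hδT : δ ∈ Icc 0 T := ⟨hδ0.le, hδτ.trans hτT⟩
  have hinit : ∀ x, 0 ≤ x → x ≤ h δ → |V δ x - u δ x| ≤ 2 * (L' * K) * δ := fun x hx hxh => by
    have h1 := abs_le.1 (hV.abs_sub_initial_le hd hJ hf hVb hL hL0 hδT hx)
    rcases le_total x h₀ with hx0 | hx0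
    · have h2 := abs_le.1 (hs.abs_sub_datum_le hd hμ0 hh₀ hJ hf hu₀ hM hMK hL hL0 hδ0.le
        ⟨hx, hx0⟩)
      rw [hV.init_inner x ⟨hx, hx0⟩] at h1
      rw [abs_le]; constructor <;> linarith
    · have h2 := abs_le.1 (hs.abs_le_mul_time hd hh₀ hJ hf hu₀ hM hMK hL hL0 hδ0.le ⟨hx0, hxh⟩)
      rw [hV.init_outer x hx0] at h1
      rw [abs_le]; constructor <;> linarith
  have hgron := abs_le_of_abs_deriv_le_nested (S := S)
    (w := fun t x => V t x - u t x) (w' := w') (a := δ) (b := T) (K := 2 * K) (L := L')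
    (E := d * (2 * K) * θ) (ε := 2 * (L' * K) * δ) (by positivity)
    (fun m x hx => ⟨hx.1, by have := hx.2; push_cast at this; linarith⟩)
    (fun x hx => (hV.continuousOn_time hδ0.le hx.1).sub
      (hs.continuousOn_time hδ0.le hx.1 fun s h1 => (hSh 0 s h1.1 x hx).le))
    (fun t ht x hx => (hV.eq_V t x (hδ0.trans ht.1) hx.1).sub
      (hs.eq_u t x (hδ0.trans ht.1) hx.1 (hSh 0 t ht.1.le x hx)))
    (fun x hx => hinit x hx.1 (hSh 0 δ le_rfl x hx).le)
    (fun t ht x hx => by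
      have h1 := abs_le.1 (hVb t ⟨hδ0.le.trans ht.1, ht.2⟩ x hx.1)
      have h2 := abs_le.1 (hub t (hδ0.le.trans ht.1) x ⟨hx.1, (hSh 0 t ht.1 x hx).le⟩)
      rw [abs_le]; constructor <;> linarith)
    hrate n
  intro t ht x hx
  have htδ : δ ≤ t := hδτ.trans ht.1
  have h1 := hgron t ⟨htδ, ht.2⟩ x ⟨hx.1, by simpa using hx.2⟩
  have h2 : 2 * K * ((L' * (t - δ)) ^ n / n.factorial) ≤ 2 * K * ((L' * T) ^ n / n.factorial) := by
    have h3 : 0 ≤ L' * (t - δ) := mul_nonneg hL'0.le (by linarith)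
    have h4 : L' * (t - δ) ≤ L' * T := mul_le_mul_of_nonneg_left (by linarith [ht.2]) hL'0.le
    gcongr
  have h3 : (2 * (L' * K) * δ + d * (2 * K) * θ * (T - δ)) * Real.exp (L' * (t - δ))
      ≤ (2 * (L' * K) * δ + d * (2 * K) * θ * T) * Q := by
    have h4 : t - δ ≤ T := by linarith [ht.2]
    have h5 : T - δ ≤ T := by linarith
    have h6 : 0 ≤ d * (2 * K) * θ := by positivity
    refine mul_le_mul ?_ (Real.exp_le_exp.2 (mul_le_mul_of_nonneg_left h4 hL'0.le))
      (Real.exp_pos _).le (by positivity)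
    linarith [mul_le_mul_of_nonneg_left h5 h6]
  linarith

end IsHalfLineSolution

/-! ### Passage to locally uniform convergence -/

theorem tendstoLocallyUniformlyOn_of_forall_eventually {X : Type*} [TopologicalSpace X]
    {F : ℝ → X → ℝ} {g : X → ℝ} {l : Filter ℝ} {s : Set X}
    (H : ∀ x ∈ s, ∃ t ∈ 𝓝 x, ∀ ε > 0, ∀ᶠ n in l, ∀ y ∈ t ∩ s, |g y - F n y| < ε) :
    TendstoLocallyUniformlyOn F g l s := by
  rw [Metric.tendstoLocallyUniformlyOn_iff]
  intro ε hε x hx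
  obtain ⟨t, ht, h1⟩ := H x hx
  exact ⟨t ∩ s, inter_mem (mem_nhdsWithin_of_mem_nhds ht) self_mem_nhdsWithin, h1 ε hε⟩

theorem tendsto_mul_exp_sub_one_zero (A B : ℝ) :
    Tendsto (fun μ : ℝ => A * (Real.exp (μ * B) - 1)) (𝓝[>] 0) (𝓝 0) := by
  have h1 : Continuous fun μ : ℝ => A * (Real.exp (μ * B) - 1) := by fun_prop
  have h2 := h1.tendsto 0
  simp only [zero_mul, Real.exp_zero, sub_self, mul_zero] at h2
  exact h2.mono_left nhdsWithin_le_nhds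

theorem IsFreeBoundarySolution.h_and_deriv_bounds {d μ h₀ : ℝ} {J f u₀ : ℝ → ℝ}
    {u : ℝ → ℝ → ℝ} {h : ℝ → ℝ} (hs : IsFreeBoundarySolution d μ h₀ J f u₀ u h) (hd : 0 < d)
    (hμ : 0 < μ) (hh₀ : 0 < h₀) (hJ : IsDispersalKernel J) (hf : IsMonostable f)
    (hu₀ : IsInitialDatum h₀ u₀) {M : ℝ} (hM : IsUpperBound h₀ f u₀ M) {t T : ℝ}
    (ht : t ∈ Ioo 0 T) :
    |h₀ - h t| ≤ h₀ * (Real.exp (μ * (M * T)) - 1) ∧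
      |deriv h t| ≤ μ * (M * (h₀ * Real.exp (μ * (M * T)))) := by
  have h1 := hs.le_h hd hμ hJ hf hu₀ ht.1.le
  have h2 := hs.h_le_exp hd hμ hh₀ hJ hf hu₀ hM ht.1.le
  have h3 : Real.exp (μ * M * t) ≤ Real.exp (μ * (M * T)) := by
    have := mul_le_mul_of_nonneg_left ht.2.le (mul_pos hμ hM.pos).le
    exact Real.exp_le_exp.2 (by linarith)
  have h4 := h2.trans (mul_le_mul_of_nonneg_left h3 hh₀.le)
  constructor
  · rw [abs_sub_comm, abs_of_nonneg (by linarith)]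
    linarith
  · have h5 := hJ.flux_nonneg fun x hx => hs.nonneg hd hJ hf hu₀ ht.1.le hx
    have h6 := hJ.flux_le (hh₀.le.trans h1) (hs.continuousOn_slice ht.1.le) hM.pos.le
      fun x hx => hs.le_of_isUpperBound hd hJ hM ht.1.le hx
    rw [(hs.eq_h t ht.1).deriv, abs_of_nonneg (mul_nonneg hμ.le h5)]
    exact mul_le_mul_of_nonneg_left (h6.trans (mul_le_mul_of_nonneg_left h4 hM.pos.le)) hμ.le

theorem theorem2p3
    (d h₀ : ℝ) (hd : 0 < d) (hh₀ : 0 < h₀)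
    (J f u₀ : ℝ → ℝ)
    (hJ : IsDispersalKernel J) (hf : IsMonostable f) (hu₀ : IsInitialDatum h₀ u₀)
    (u : ℝ → ℝ → ℝ → ℝ) (h : ℝ → ℝ → ℝ)
    (huh : ∀ μ : ℝ, 0 < μ → IsFreeBoundarySolution d μ h₀ J f u₀ (u μ) (h μ))
    (v V : ℝ → ℝ → ℝ)
    (hv : IsFixedDomainSolution d h₀ J f u₀ v)
    (hV : IsHalfLineSolution d h₀ J f u₀ V) :
    -- the limit `μ → 0`
    (TendstoLocallyUniformlyOn
        (fun (μ : ℝ) (p : ℝ × ℝ) => u μ p.1 p.2) (fun p => v p.1 p.2)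
        (𝓝[>] 0) (Ioi 0 ×ˢ Icc 0 h₀) ∧
      TendstoLocallyUniformlyOn
        (fun (μ : ℝ) (p : ℝ × ℝ) => deriv (fun s => u μ s p.2) p.1)
        (fun p => deriv (fun s => v s p.2) p.1)
        (𝓝[>] 0) (Ioi 0 ×ˢ Icc 0 h₀) ∧
      TendstoLocallyUniformlyOn h (fun _ => h₀) (𝓝[>] 0) (Ioi 0) ∧
      TendstoLocallyUniformlyOn (fun μ => deriv (h μ)) (fun _ => 0) (𝓝[>] 0) (Ioi 0)) ∧
    -- the limit `μ → ∞`
    (TendstoLocallyUniformlyOn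
        (fun (μ : ℝ) (p : ℝ × ℝ) => u μ p.1 p.2) (fun p => V p.1 p.2)
        atTop (Ioi 0 ×ˢ Ioi 0) ∧
      ∀ K : Set ℝ, IsCompact K → K ⊆ Ioi 0 →
        ∀ M : ℝ, ∀ᶠ μ in atTop, ∀ t ∈ K, M ≤ h μ t) := by
  obtain ⟨M, hM⟩ := hu₀.exists_isUpperBound hf
  have hfixed : ∀ T > 0, ∀ ε > 0, ∀ᶠ μ in 𝓝[>] (0 : ℝ), ∀ t ∈ Ioo 0 T, ∀ x ∈ Icc 0 h₀,
      |v t x - u μ t x| < ε ∧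
        |deriv (fun s => v s x) t - deriv (fun s => u μ s x) t| < ε := by
    intro T hT ε hε
    obtain ⟨A, hA⟩ := hv.exists_estimate hd hh₀ hJ hf hu₀ hM hT
    filter_upwards [self_mem_nhdsWithin,
      (tendsto_mul_exp_sub_one_zero A (M * T)).eventually_lt_const hε] with μ hμ hlt t ht x hx
    rw [← mul_assoc] at hlt
    obtain ⟨h1, h2⟩ := hA μ hμ _ _ (huh μ hμ) t ht x hx
    exact ⟨h1.trans_lt hlt, h2.trans_lt hlt⟩
  have hnhds : ∀ p ∈ (Ioi 0 ×ˢ Icc 0 h₀ : Set (ℝ × ℝ)),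
      (Ioo 0 (p.1 + 1) ×ˢ univ : Set (ℝ × ℝ)) ∈ 𝓝 p := fun p hp =>
    (isOpen_Ioo.prod isOpen_univ).mem_nhds ⟨⟨hp.1, lt_add_one _⟩, trivial⟩
  refine ⟨⟨?_, ?_, ?_, ?_⟩, ?_, ?_⟩
  · refine tendstoLocallyUniformlyOn_of_forall_eventually fun p hp => ⟨_, hnhds p hp, ?_⟩
    intro ε hε
    have hp1 : 0 < p.1 := hp.1
    filter_upwards [hfixed (p.1 + 1) (by linarith) ε hε] with μ hμ q hq
    exact (hμ q.1 hq.1.1 q.2 hq.2.2).1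
  · refine tendstoLocallyUniformlyOn_of_forall_eventually fun p hp => ⟨_, hnhds p hp, ?_⟩
    intro ε hε
    have hp1 : 0 < p.1 := hp.1
    filter_upwards [hfixed (p.1 + 1) (by linarith) ε hε] with μ hμ q hq
    exact (hμ q.1 hq.1.1 q.2 hq.2.2).2
  · refine tendstoLocallyUniformlyOn_of_forall_eventually fun t ht =>
      ⟨Ioo 0 (t + 1), Ioo_mem_nhds ht (lt_add_one t), fun ε hε => ?_⟩
    filter_upwards [self_mem_nhdsWithin,
      (tendsto_mul_exp_sub_one_zero h₀ (M * (t + 1))).eventually_lt_const hε] with μ hμ hlt y hy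
    exact ((huh μ hμ).h_and_deriv_bounds hd hμ hh₀ hJ hf hu₀ hM hy.1).1.trans_lt hlt
  · refine tendstoLocallyUniformlyOn_of_forall_eventually fun t ht =>
      ⟨Ioo 0 (t + 1), Ioo_mem_nhds ht (lt_add_one t), fun ε hε => ?_⟩
    have h1 : Continuous fun μ : ℝ => μ * (M * (h₀ * Real.exp (μ * (M * (t + 1))))) := by fun_prop
    have h2 := h1.tendsto 0
    rw [zero_mul] at h2
    filter_upwards [self_mem_nhdsWithin,
      (h2.mono_left nhdsWithin_le_nhds).eventually_lt_const hε] with μ hμ hlt y hy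
    rw [zero_sub, abs_neg]
    exact ((huh μ hμ).h_and_deriv_bounds hd hμ hh₀ hJ hf hu₀ hM hy.1).2.trans_lt hlt
  · refine tendstoLocallyUniformlyOn_of_forall_eventually fun p hp =>
      -- Times stay above `p.1 / 2`, since the front needs a positive delay to pass `p.2 + 1`.
      ⟨Ioo (p.1 / 2) (p.1 + 1) ×ˢ Iio (p.2 + 1), (isOpen_Ioo.prod isOpen_Iio).mem_nhds
        ⟨⟨half_lt_self hp.1, lt_add_one _⟩, mem_Iio.2 (lt_add_one p.2)⟩, fun ε hε => ?_⟩
    have hp1 : 0 < p.1 := hp.1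
    obtain ⟨μ₀, -, H⟩ := hV.exists_estimate hd hh₀ hJ hf hu₀ (b := p.2 + 1) (half_pos hp1)
      (by linarith : p.1 / 2 ≤ p.1 + 1) hε
    filter_upwards [eventually_ge_atTop μ₀, eventually_gt_atTop 0] with μ hμ hμ0 q hq
    exact H μ hμ _ _ (huh μ hμ0) q.1 (Ioo_subset_Icc_self hq.1.1) q.2
      ⟨le_of_lt hq.2.2, le_of_lt hq.1.2⟩
  · intro K hK hK0 R
    rcases K.eq_empty_or_nonempty with rfl | hne
    · simp
    obtain ⟨δ, hδK, hδ⟩ := hK.exists_isMinOn hne continuousOn_id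
    obtain ⟨μ₀, -, H⟩ := exists_forall_le_h_of_large_rate hd hh₀ hJ hf hu₀ (hK0 hδK) R
    filter_upwards [eventually_ge_atTop μ₀, eventually_gt_atTop 0] with μ hμ hμ0 t ht
    exact H μ hμ _ _ (huh μ hμ0) t (hδ ht)
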